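/- Setting. Let $(X,\mu)$ be a standard Borel probability space, $\mathcal R\subset X\times X$ a Borel equivalence relation with countable classes, and $\mathcal S\subset\mathcal R$ a Borel subequivalence relation. Put $\mu_L(A)=\int|\{y:(x,y)\in A\}|\,d\mu(x)$ and $\mu_R(A)=\int|\{x:(x,y)\in A\}|\,d\mu(y)$ for Borel $A\subset\mathcal R$. Assume that $\mu$ is $\mathcal R$-quasi-invariant ($\mu_L$ and $\mu_R$ have the same null sets) and that $\mathcal R$ is ergodic (every Borel union of $\mathcal R$-classes has measure $0$ or $1$). Statements about pairs in $\mathcal R$ are understood $\mu_L$-almost everywhere; in particular $\ker(\cdot)=\mathcal S$ and $\ker(\cdot)\supset\mathcal S$ are meant almost everywhere. A family of choice functions for $\mathcal S\subset\mathcal R$ is a family of Borel maps $\phi_j:X\to X$, $j\in J$, with $|J|=N\in\mathbb N\cup\{\infty\}$, such that for a.e. $x$ the classes $[\phi_j(x)]_{\mathcal S}$, $j\in J$, form a partition of $[x]_{\mathcal R}$ (so $N$ is the index $[\mathcal R:\mathcal S]$). Its index cocycle $\sigma:\mathcal R\to\mathrm{Sym}(J)$ is given by $\sigma(x,y)(i)=j\iff(\phi_j(x),\phi_i(y))\in\mathcal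 S$. Let $\mathcal S\times_\sigma J$ be the relation on $X\times J$ with $(x,i)\sim(y,j)$ iff $(x,y)\in\mathcal S$ and $i=\sigma(x,y)(j)$, and let $\rho:\mathcal S\times_\sigma J\to\mathcal S$ be the extension induced by $(x,i)\mapsto x$. A discrete Borel groupoid is a groupoid with standard Borel arrow and unit spaces, Borel structure maps, and countable source fibres. A discrete ergodic measured groupoid $(\mathcal H,\nu)$ is a discrete Borel groupoid $\mathcal H$ with a probability measure $\nu$ on its unit space that is quasi-invariant (integrating over $\nu$ the counting measures on source fibres, respectively on range fibres, gives measures on $\mathcal H$ with the same null sets) and ergodic (every invariant Borel set of units has measure $0$ or $1$). A homomorphism of discrete Borel groupoids is a Borel functor; between measured groupoids it is moreover required that preimages of null sets of units are null. $\mathcal R$ is regarded as a groupoid in which $(x,y)$ has range $x$ and source $y$; for a homomorphism $\theta$ on $\mathcal R$ write $\theta(x)$ for the unit $\theta(x,x)$, and $\ker(\theta)$ for the set of $(x,y)\in\mathcal R$ such that $\theta(x,y)$ is a unit. Theorem. A family of choice functions for $\mathcal S\subset\mathcal R$ exists, and for every such family, with index set $J$ and index cocycle $\sigma$, the following are equivalent.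 1. $\mathcal S$ is normal in $\mathcal R$ in the sense of Feldman, Sutherland and Zimmer: the restriction of $\sigma$ to $\mathcal S$ is a coboundary, i.e. there is a Borel map $\psi:X\to\mathrm{Sym}(J)$ with $\sigma(x,y)=\psi(x)\psi(y)^{-1}$ for a.e. $(x,y)\in\mathcal S$. 2. There is a family of choice functions $\{\phi'_j\}_{j\in J}$ for $\mathcal S\subset\mathcal R$ such that for every $j$ and a.e. $(x,y)\in\mathcal S$ one has $(\phi'_j(x),\phi'_j(y))\in\mathcal S$. 3. The extension $\rho:\mathcal S\times_\sigma J\to\mathcal S$ is normal in the sense of Zimmer: the unitary cocycle $(x,y)\mapsto U_{\sigma(x,y)}$ of $\mathcal S$ on $L^2(\rho^{-1}(x))=\ell^2(J)$, where $(U_pv)(p(k))=v(k)$, becomes trivial when pulled back along $\rho$, i.e. there is a Borel field $W$ of unitary operators on $\ell^2(J)$ indexed by $X\times J$ with $U_{\sigma(x,y)}=W(x,i)W(y,j)^{-1}$ for a.e. $(x,i)\sim(y,j)$ in $\mathcal S\times_\sigma J$. 4. There are a discrete ergodic measured groupoid $(\mathcal H,\nu)$ and a homomorphism $\theta:\mathcal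 R\to\mathcal H$ of measured groupoids such that (a) $\ker(\theta)=\mathcal S$; (b) $\theta$ is class-surjective: for a.e. $x\in X$ and every $h\in\mathcal H$ with source $\theta(x)$ there is $y\in[x]_{\mathcal R}$ with $\theta(y,x)=h$; (c) for every discrete ergodic measured groupoid $(\mathcal H',\nu')$ and every homomorphism $\theta':\mathcal R\to\mathcal H'$ of measured groupoids with $\ker(\theta')\supset\mathcal S$ there is a homomorphism $\kappa:\mathcal H\to\mathcal H'$ of measured groupoids with $\kappa\theta=\theta'$ almost everywhere. 5. There are a discrete Borel groupoid $\mathcal G$ and a Borel homomorphism $c:\mathcal R\to\mathcal G$ with $\ker(c)=\mathcal S$. -/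

import Mathlib

open MeasureTheory
open scoped ENNReal

universe u

/-- A discrete Borel groupoid: a groupoid whose unit space `Obj` and arrow space `Arr` are standard
Borel, whose structure maps are Borel, and in which only countably many arrows start at any given
unit (hence, by inversion, only countably many end there). An arrow `g` goes from `src g` to
`rng g`, and `mul g h` means "first `h`, then `g`". Units are embedded in `Arr` by `one`. -/
structure DiscreteBorelGroupoid : Type (u + 1) where
  Obj : Type u
  Arr : Type u
  [measurableSpaceObj : MeasurableSpace Obj]
  [standardBorelSpaceObj : StandardBorelSpace Obj]
  [measurableSpaceArr : MeasurableSpace Arr]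
  [standardBorelSpaceArr : StandardBorelSpace Arr]
  src : Arr → Obj
  rng : Arr → Obj
  one : Obj → Arr
  inv : Arr → Arr
  mul : (g h : Arr) → src g = rng h → Arr
  src_one : ∀ x, src (one x) = x
  rng_one : ∀ x, rng (one x) = x
  src_inv : ∀ g, src (inv g) = rng g
  rng_inv : ∀ g, rng (inv g) = src g
  src_mul : ∀ g h e, src (mul g h e) = src h
  rng_mul : ∀ g h e, rng (mul g h e) = rng g
  mul_assoc : ∀ (g h k : Arr) (e : src g = rng h) (f : src h = rng k),
    mul (mul g h e) k ((src_mul g h e).trans f) = mul g (mul h k f) (e.trans (rng_mul h k f).symm)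
  one_mul : ∀ g, mul (one (rng g)) g (src_one _) = g
  mul_one : ∀ g, mul g (one (src g)) (rng_one _).symm = g
  inv_mul : ∀ g, mul (inv g) g (src_inv g) = one (src g)
  mul_inv : ∀ g, mul g (inv g) (rng_inv g).symm = one (rng g)
  measurable_src : Measurable src
  measurable_rng : Measurable rng
  measurable_one : Measurable one
  measurable_inv : Measurable inv
  measurable_mul : Measurable fun p : {p : Arr × Arr // src p.1 = rng p.2} =>
    mul p.1.1 p.1.2 p.2
  countable_src : ∀ x, {g | src g = x}.Countable

namespace DiscreteBorelGroupoid

attribute [instance] measurableSpaceObj standardBorelSpaceObj measurableSpaceArr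
  standardBorelSpaceArr

/-- The mass `∫ |A ∩ rng⁻¹(x)| dν(x)` of a set of arrows. For the groupoid of an equivalence
relation this is `μ_L(A) = ∫ |A_x| dμ(x)`. -/
noncomputable def leftMass (G : DiscreteBorelGroupoid.{u}) (ν : Measure G.Obj) (A : Set G.Arr) :
    ℝ≥0∞ :=
  ∫⁻ x, (({g | g ∈ A ∧ G.rng g = x} : Set G.Arr).encard : ℝ≥0∞) ∂ν

/-- The mass `∫ |A ∩ src⁻¹(y)| dν(y)` of a set of arrows. For the groupoid of an equivalence
relation this is `μ_R(A) = ∫ |A^y| dμ(y)`. -/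
noncomputable def rightMass (G : DiscreteBorelGroupoid.{u}) (ν : Measure G.Obj) (A : Set G.Arr) :
    ℝ≥0∞ :=
  ∫⁻ y, (({g | g ∈ A ∧ G.src g = y} : Set G.Arr).encard : ℝ≥0∞) ∂ν

/-- The two measures on the arrow space have the same null sets. -/
def QuasiInvariant (G : DiscreteBorelGroupoid.{u}) (ν : Measure G.Obj) : Prop :=
  ∀ A : Set G.Arr, MeasurableSet A → (G.leftMass ν A = 0 ↔ G.rightMass ν A = 0)

/-- Every Borel set of units that is a union of orbits has measure `0` or `1`
(this is used for probability measures only). -/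
def Ergodic (G : DiscreteBorelGroupoid.{u}) (ν : Measure G.Obj) : Prop :=
  ∀ A : Set G.Obj, MeasurableSet A → (∀ g, G.src g ∈ A ↔ G.rng g ∈ A) → ν A = 0 ∨ ν A = 1

/-- `ν` makes `G` a discrete ergodic measured groupoid. -/
structure IsErgodicMeasured (G : DiscreteBorelGroupoid.{u}) (ν : Measure G.Obj) : Prop where
  isProbabilityMeasure : IsProbabilityMeasure ν
  quasiInvariant : G.QuasiInvariant ν
  ergodic : G.Ergodic ν

/-- Borel homomorphisms of discrete Borel groupoids. -/
structure Hom (G H : DiscreteBorelGroupoid.{u}) : Type u where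
  obj : G.Obj → H.Obj
  arr : G.Arr → H.Arr
  measurable_obj : Measurable obj
  measurable_arr : Measurable arr
  src_arr : ∀ g, H.src (arr g) = obj (G.src g)
  rng_arr : ∀ g, H.rng (arr g) = obj (G.rng g)
  arr_mul : ∀ (g h : G.Arr) (e : G.src g = G.rng h),
    arr (G.mul g h e) =
      H.mul (arr g) (arr h) ((src_arr g).trans ((congrArg obj e).trans (rng_arr h).symm))

/-- A homomorphism of measured groupoids: null sets of units pull back to null sets. -/
def Hom.Nonsingular {G H : DiscreteBorelGroupoid.{u}} (f : G.Hom H) (μ : Measure G.Obj)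
    (ν : Measure H.Obj) : Prop :=
  (μ.map f.obj).AbsolutelyContinuous ν

end DiscreteBorelGroupoid

/-- A discrete Borel equivalence relation: Borel as a subset of `X × X`, with countable classes. -/
structure DiscreteBorelEquivRel (X : Type u) [MeasurableSpace X] extends Setoid X where
  measurableSet_graph : MeasurableSet {p : X × X | r p.1 p.2}
  countable_class : ∀ x, {y | r x y}.Countable

/-- An equivalence relation as a groupoid: the arrow `(x, y)` has range `x` and source `y`, and
`(x, y) (y, z) = (x, z)`. -/
abbrev DiscreteBorelEquivRel.toGroupoid {X : Type u} [MeasurableSpace X] [StandardBorelSpace X]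
    (R : DiscreteBorelEquivRel X) : DiscreteBorelGroupoid.{u} where
  Obj := X
  Arr := {p : X × X // R.r p.1 p.2}
  standardBorelSpaceArr := R.measurableSet_graph.standardBorel
  src p := p.1.2
  rng p := p.1.1
  one x := ⟨(x, x), R.iseqv.refl x⟩
  inv p := ⟨(p.1.2, p.1.1), R.iseqv.symm p.2⟩
  mul p q e := ⟨(p.1.1, q.1.2), R.iseqv.trans p.2 (e ▸ q.2)⟩
  src_one _ := rfl
  rng_one _ := rfl
  src_inv _ := rfl
  rng_inv _ := rfl
  src_mul _ _ _ := rfl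
  rng_mul _ _ _ := rfl
  mul_assoc _ _ _ _ _ := rfl
  one_mul _ := rfl
  mul_one _ := rfl
  inv_mul _ := rfl
  mul_inv _ := rfl
  measurable_src := measurable_snd.comp measurable_subtype_coe
  measurable_rng := measurable_fst.comp measurable_subtype_coe
  measurable_one := (measurable_id.prodMk measurable_id).subtype_mk
  measurable_inv := (measurable_subtype_coe.snd.prodMk measurable_subtype_coe.fst).subtype_mk
  measurable_mul := by
    refine Measurable.subtype_mk (Measurable.prodMk ?_ ?_)
    · exact (measurable_subtype_coe.comp measurable_subtype_coe.fst).fst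
    · exact (measurable_subtype_coe.comp measurable_subtype_coe.snd).snd
  countable_src y := by
    refine Set.Countable.mono (s₂ := (fun p : {p : X × X // R.r p.1 p.2} => p.1.1) ⁻¹'
      {x | R.r y x} ∩ {p | p.1.2 = y}) ?_ ?_
    · rintro ⟨⟨a, b⟩, hab⟩ rfl
      exact ⟨R.iseqv.symm hab, rfl⟩
    · refine Set.MapsTo.countable_of_injOn (t := {x | R.r y x})
        (f := fun p : {p : X × X // R.r p.1 p.2} => p.1.1) (fun p hp => hp.1) ?_
        (R.countable_class y)
      rintro ⟨⟨a, b⟩, h⟩ ⟨_, rfl⟩ ⟨⟨c, d⟩, h'⟩ ⟨_, hd⟩ hac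
      have h1 : d = b := hd
      have h2 : a = c := hac
      subst h1 h2
      rfl

/-- The index set `J` with `N` elements, `N` finite or infinite. -/
abbrev IndexSet (N : ℕ∞) : Type := {j : ℕ // (j : ℕ∞) < N}

section

variable {X : Type u} [MeasurableSpace X]

/-- `(φ j)` is a family of choice functions for `S ⊆ R`: Borel maps such that, for almost every
`x`, the classes `[φ j x]_S`, `j ∈ J`, form a partition of `[x]_R`. In particular `N` is the number
of `S`-classes in almost every `R`-class, that is, the index `[R : S]`. -/
structure IsChoiceFamily (μ : Measure X) (R S : DiscreteBorelEquivRel X) {N : ℕ∞}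
    (φ : IndexSet N → X → X) : Prop where
  measurable : ∀ j, Measurable (φ j)
  rel : ∀ᵐ x ∂μ, ∀ j, R.r x (φ j x)
  partition : ∀ᵐ x ∂μ, ∀ y, R.r x y → ∃! j, S.r (φ j x) y

/-- `φ` maps `S`-equivalent points to `S`-equivalent points, almost everywhere. -/
def IsEndomorphism (μ : Measure X) (S : DiscreteBorelEquivRel X) (φ : X → X) : Prop :=
  ∀ᵐ x ∂μ, ∀ y, S.r x y → S.r (φ x) (φ y)

open Classical in
/-- The index cocycle `σ : R → Sym(J)` of a family of choice functions: `σ(x, y)` sends `i` to the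
`j` with `φ j x` and `φ i y` equivalent under `S`. (For almost every `x` and all `y ∈ [x]_R` there
is exactly one such permutation.) -/
noncomputable def indexCocycle (S : DiscreteBorelEquivRel X) {N : ℕ∞} (φ : IndexSet N → X → X)
    (x y : X) : Equiv.Perm (IndexSet N) :=
  if h : ∃ p : Equiv.Perm (IndexSet N), ∀ i, S.r (φ (p i) x) (φ i y) then h.choose else 1

/-- The cocycle `σ`, restricted to `S`, is a coboundary: `σ(x, y) = ψ(x) ψ(y)⁻¹` almost everywhere
on `S` for a Borel map `ψ : X → Sym(J)`. The Borel structure of `Sym(J)` is that of the topology of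
pointwise convergence, so it is generated by the evaluations. -/
def IsCoboundaryOn (μ : Measure X) (S : DiscreteBorelEquivRel X) {N : ℕ∞}
    (σ : X → X → Equiv.Perm (IndexSet N)) : Prop :=
  ∃ ψ : X → Equiv.Perm (IndexSet N), (∀ i, Measurable fun x => ψ x i) ∧
    ∀ᵐ x ∂μ, ∀ y, S.r x y → σ x y = ψ x * (ψ y)⁻¹

/-- The relation `S ×_σ J` on `X × J`: `(x, i) ∼ (y, j)` iff `(x, y) ∈ S` and `i = σ(x, y) j`. -/
def SkewProductRel (S : DiscreteBorelEquivRel X) {N : ℕ∞}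
    (σ : X → X → Equiv.Perm (IndexSet N)) (p q : X × IndexSet N) : Prop :=
  S.r p.1 q.1 ∧ p.2 = σ p.1 q.1 q.2

/-- Zimmer's normality of the extension `ρ : S ×_σ J → S`, `ρ(x, i) = x`. The extension carries the
unitary cocycle representation `(x, y) ↦ U_{σ(x, y)}` of `S` on the spaces `L²(ρ⁻¹(x)) = ℓ²(J)`,
where `(U_p v)(p k) = v k`. The extension is normal if the pullback of this cocycle along `ρ` to
`S ×_σ J` is trivial: `U_{σ(x, y)} = W(x, i) W(y, j)⁻¹` for almost all `(x, i) ∼ (y, j)`, with a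
Borel field `W` of unitaries. The last line below says `W p = U_{σ(p.1, q.1)} ∘ W q`. -/
def IsZimmerNormal (μ : Measure X) (S : DiscreteBorelEquivRel X) {N : ℕ∞}
    (σ : X → X → Equiv.Perm (IndexSet N)) : Prop :=
  ∃ W : X × IndexSet N →
      (lp (fun _ : IndexSet N => ℂ) 2 ≃ₗᵢ[ℂ] lp (fun _ : IndexSet N => ℂ) 2),
    (∀ v k, Measurable fun p => W p v k) ∧
    ∀ᵐ p ∂(μ.prod (Measure.count : Measure (IndexSet N))), ∀ q, SkewProductRel S σ p q →
      ∀ v k, W p v (σ p.1 q.1 k) = W q v k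

variable [StandardBorelSpace X] {R : DiscreteBorelEquivRel X} {H : DiscreteBorelGroupoid.{u}}

/-- The kernel of a homomorphism `θ : R → H`: the pairs `(x, y) ∈ R` for which `θ(x, y)` is a
unit. -/
def relKer (θ : R.toGroupoid.Hom H) : Set (X × X) :=
  {p | ∃ h : R.r p.1 p.2, θ.arr ⟨p, h⟩ ∈ Set.range H.one}

/-- `ker θ` contains `S`, almost everywhere. -/
def KerContains (μ : Measure X) (θ : R.toGroupoid.Hom H) (S : DiscreteBorelEquivRel X) : Prop :=
  ∀ᵐ x ∂μ, ∀ y, S.r x y → (x, y) ∈ relKer θ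

/-- `ker θ` and `S` agree almost everywhere. -/
def KerEq (μ : Measure X) (θ : R.toGroupoid.Hom H) (S : DiscreteBorelEquivRel X) : Prop :=
  ∀ᵐ x ∂μ, ∀ y, (x, y) ∈ relKer θ ↔ S.r x y

/-- For almost every `x`, every arrow of `H` with source `θ(x)` is `θ(y, x)` for some
`y ∈ [x]_R`. -/
def ClassSurjective (μ : Measure X) (θ : R.toGroupoid.Hom H) : Prop :=
  ∀ᵐ x ∂μ, ∀ h : H.Arr, H.src h = θ.obj x → ∃ y, ∃ hy : R.r y x, θ.arr ⟨(y, x), hy⟩ = h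

/-- Any homomorphism from `R` to a discrete ergodic measured groupoid whose kernel contains `S`
factors through `θ : R → (H, ν)`, almost everywhere. -/
def IsUniversalFor (μ : Measure X) (S : DiscreteBorelEquivRel X) (θ : R.toGroupoid.Hom H)
    (ν : Measure H.Obj) : Prop :=
  ∀ (H' : DiscreteBorelGroupoid.{u}) (ν' : Measure H'.Obj) (θ' : R.toGroupoid.Hom H'),
    H'.IsErgodicMeasured ν' → θ'.Nonsingular μ ν' → KerContains μ θ' S →
      ∃ κ : H.Hom H', κ.Nonsingular ν ν' ∧
        ∀ᵐ x ∂μ, ∀ y, ∀ hy : R.r x y, κ.arr (θ.arr ⟨(x, y), hy⟩) = θ'.arr ⟨(x, y), hy⟩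

end

/-! Normality of `S` means that `R` has a quotient groupoid by `S`. Choice functions index the
`S`-classes inside a class of `R`, and the index cocycle records how the indexing varies with the
base point. The cocycle is trivial on `S` exactly when the indexing can be made to depend only on
the `S`-class of the base point, that is, when the choice functions can be taken to be endomorphisms
of `S`.

From endomorphisms to the quotient: let `P` generate the σ-algebra of `S`-invariant Borel sets up to
null sets. The index of the class of `φ i (φ j x)`, the index of the class of `x`, and the value `P
(φ j x)` are `S`-invariant functions of `x`, hence Borel functions of `P x`. So the pairs `(P x,
j)`, standing for `(φ j x, x)`, are the arrows of a groupoid onto which `R` maps with kernel `S`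
(`exists_isQuotientMap`, `IsQuotientMap.exists_hom`). A homomorphism whose kernel contains `S` is
unchanged when points are moved inside their `S`-classes, so it factors through `P` as well; this is
universality.

Back to the coboundary: a homomorphism `c` with kernel `S` attaches to `(x, k)` the arrow `c (φ k x,
x)`, and a trivialization `W` of the unitary cocycle attaches to it the preimage under `W (x, i)` of
the `k`-th basis vector, for a suitable `i`. These objects are distinct for distinct `k` and are
transported by the cocycle over `S`. Countability of source fibres, or separability of `ℓ²`,
replaces them by natural numbers, and sorting the numbers at each `x` gives `ψ`
(`isCoboundaryOn_of_label`).

Two tools serve throughout: the measure-theoretic Lusin–Novikov theorem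
`exists_measurable_fiber_label`, which enumerates classes and labels source fibres, and
`exists_isConullInvariant`, which moves exceptional null sets off whole classes. -/

section

open Set TopologicalSpace Filter Topology DiscreteBorelGroupoid

/-! ### Borel labellings of countable fibres. -/

section LusinNovikov

/-- A measurable labelling by natural numbers separates the points of almost every fibre of `f`
that lie in `A`. -/
def HasFiberLabel {Z X : Type*} [MeasurableSpace Z] [MeasurableSpace X] (μ : Measure X)
    (f : Z → X) (A : Set Z) : Prop :=
  ∃ l : Z → ℕ, Measurable l ∧ ∀ᵐ x ∂μ, InjOn l (A ∩ f ⁻¹' {x})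

section

variable {Z X : Type*} [MeasurableSpace Z] [MeasurableSpace X] {μ : Measure X} {f : Z → X}

theorem HasFiberLabel.mono {A B : Set Z} (h : HasFiberLabel μ f B) (hAB : A ⊆ B) :
    HasFiberLabel μ f A := by
  obtain ⟨l, hl, h⟩ := h
  exact ⟨l, hl, h.mono fun x hx => hx.mono (inter_subset_inter_left _ hAB)⟩

-- The labels are combined by pairing: the number of the first piece containing the point, and the
-- label inside that piece.
open Classical in
theorem HasFiberLabel.iUnion {ι : Type*} [Countable ι] {A : ι → Set Z}
    (hA : ∀ i, MeasurableSet (A i)) (h : ∀ i, HasFiberLabel μ f (A i)) :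
    HasFiberLabel μ f (⋃ i, A i) := by
  rcases isEmpty_or_nonempty ι with hι | hι
  · exact ⟨fun _ => 0, measurable_const, by simp⟩
  obtain ⟨e, he⟩ := exists_surjective_nat ι
  choose l hl hinj using h
  let B : Set Z := ⋃ i, A i
  have hB : MeasurableSet B := .iUnion hA
  let P : Z → ℕ → Prop := fun z n => z ∈ A (e n) ∨ z ∉ B
  have hP : ∀ z, ∃ n, P z n := fun z => by
    by_cases hz : z ∈ B
    · obtain ⟨i, hi⟩ := mem_iUnion.1 hz
      obtain ⟨n, rfl⟩ := he i
      exact ⟨n, .inl hi⟩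
    · exact ⟨0, .inr hz⟩
  let ν : Z → ℕ := fun z => Nat.find (hP z)
  have hν : Measurable ν := measurable_find hP fun n => (hA (e n)).union hB.compl
  have hlab : Measurable fun z => l (e (ν z)) z := by
    refine measurable_from_prod_countable_right (f := fun q : ℕ × Z => l (e q.1) q.2)
      (fun n => hl (e n)) |>.comp (hν.prodMk measurable_id)
  refine ⟨fun z => Nat.pair (ν z) (l (e (ν z)) z),
    (measurable_of_countable fun q : ℕ × ℕ => Nat.pair q.1 q.2).comp (hν.prodMk hlab), ?_⟩
  filter_upwards [ae_all_iff.2 hinj] with x hx z hz z' hz' hzz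
  obtain ⟨h1, h2⟩ := Nat.pair_eq_pair.1 hzz
  have m1 : z ∈ A (e (ν z)) := (Nat.find_spec (hP z)).resolve_right (not_not.2 hz.1)
  have m2 : z' ∈ A (e (ν z')) := (Nat.find_spec (hP z')).resolve_right (not_not.2 hz'.1)
  rw [← h1] at m2 h2
  exact hx _ ⟨m1, hz.2⟩ ⟨m2, hz'.2⟩ h2

theorem hasFiberLabel_of_injOn {A : Set Z} (h : InjOn f A) : HasFiberLabel μ f A :=
  ⟨fun _ => 0, measurable_const, .of_forall fun x z hz z' hz' _ =>
    h hz.1 hz'.1 ((show f z = x from hz.2).trans (show f z' = x from hz'.2).symm)⟩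

/-- A largest measurable set over which `A` has a fibre label. -/
theorem exists_maximal_hasFiberLabel [IsFiniteMeasure μ] (hf : Measurable f) {A : Set Z}
    (hA : MeasurableSet A) :
    ∃ G, MeasurableSet G ∧ HasFiberLabel μ f (A ∩ f ⁻¹' G) ∧
      ∀ G', MeasurableSet G' → HasFiberLabel μ f (A ∩ f ⁻¹' G') → ∀ᵐ x ∂μ, x ∈ G' → x ∈ G := by
  let F : Set (Set X) := {G | MeasurableSet G ∧ HasFiberLabel μ f (A ∩ f ⁻¹' G)}
  have hne : (μ '' F).Nonempty :=
    ⟨_, ∅, ⟨.empty, hasFiberLabel_of_injOn (by simp)⟩, rfl⟩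
  obtain ⟨u, -, hu, hmem⟩ := exists_seq_tendsto_sSup hne (OrderTop.bddAbove _)
  choose G hG hGu using hmem
  -- Exhaustion: `F` is closed under countable unions, so the union of a maximizing sequence attains
  -- the supremum of the measures.
  have hU : (⋃ n, G n) ∈ F := by
    refine ⟨.iUnion fun n => (hG n).1, ?_⟩
    rw [preimage_iUnion, inter_iUnion]
    exact .iUnion (fun n => hA.inter (hf (hG n).1)) fun n => (hG n).2
  have hsup : ∀ G' ∈ F, μ G' ≤ μ (⋃ n, G n) := fun G' hG' => by
    refine (le_sSup (mem_image_of_mem μ hG')).trans (le_of_tendsto' hu fun n => ?_)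
    rw [← hGu n]
    exact measure_mono (subset_iUnion _ _)
  refine ⟨_, hU.1, hU.2, fun G' hG' hl => ?_⟩
  have h2 : (G' ∪ ⋃ n, G n) ∈ F := by
    refine ⟨hG'.union hU.1, ?_⟩
    rw [union_eq_iUnion, preimage_iUnion, inter_iUnion]
    refine .iUnion (fun b => hA.inter (hf ?_)) fun b => ?_
    · cases b
      exacts [hU.1, hG']
    · cases b
      exacts [hU.2, hl]
  have h3 := hsup _ h2
  have h4 : μ (G' \ ⋃ n, G n) = 0 := by
    have h5 := measure_sdiff_add_inter (μ := μ) (G' ∪ ⋃ n, G n) hU.1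
    rw [union_sdiff_right, inter_eq_right.2 subset_union_right] at h5
    have h6 : μ (G' \ ⋃ n, G n) + μ (⋃ n, G n) ≤ 0 + μ (⋃ n, G n) := by
      rw [h5, zero_add]; exact h3
    exact le_zero_iff.1 ((ENNReal.add_le_add_iff_right (measure_ne_top _ _)).1 h6)
  rw [ae_iff]
  convert h4 using 2
  ext x
  simp

end

/-- A countable-to-one continuous map from a Polish space has a fibre label. -/
theorem hasFiberLabel_of_continuous {Z X : Type*} [TopologicalSpace Z] [PolishSpace Z]
    [MeasurableSpace Z] [BorelSpace Z] [TopologicalSpace X] [PolishSpace X] [MeasurableSpace X]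
    [BorelSpace X] (μ : Measure X) [IsFiniteMeasure μ] {f : Z → X} (hf : Continuous f)
    (hc : ∀ x, (f ⁻¹' {x}).Countable) : HasFiberLabel μ f univ := by
  let := upgradeIsCompletelyMetrizable Z
  let β := countableBasis Z
  have : Countable β := (countable_countableBasis Z).to_subtype
  let U : β → Set Z := Subtype.val
  have hUo : ∀ a, IsOpen (U a) := fun a => isOpen_of_mem_countableBasis a.2
  have hUb : ∀ {z : Z} {V : Set Z}, IsOpen V → z ∈ V → ∃ a, z ∈ U a ∧ U a ⊆ V := fun hV hz => by
    obtain ⟨v, hv, h⟩ := (isBasis_countableBasis Z).exists_subset_of_mem_open hz hV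
    exact ⟨⟨v, hv⟩, h⟩
  -- `G a` is the largest set of base points over which `U a` has a label. The claim is that almost
  -- every `x` lies in every `G a`; otherwise a fibre would contain a nonempty perfect set and be
  -- uncountable.
  choose G hGm hGl hGmax using fun a =>
    exists_maximal_hasFiberLabel (μ := μ) hf.measurable (hUo a).measurableSet
  have hUnion : HasFiberLabel μ f (⋃ a, U a ∩ f ⁻¹' G a) :=
    .iUnion (fun a => (hUo a).measurableSet.inter (hf.measurable (hGm a))) hGl
  have h1 : ∀ᵐ x ∂μ, ∀ a, x ∉ closure (f '' U a) → x ∈ G a :=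
    ae_all_iff.2 fun a => hGmax a _ isClosed_closure.measurableSet.compl
      (hasFiberLabel_of_injOn fun z hz =>
        absurd (subset_closure (mem_image_of_mem f hz.1)) hz.2)
  have h2 : ∀ (S : Set β) a, (U a ⊆ ⋃ b ∈ S, U b) → ∀ᵐ x ∂μ, (∀ b ∈ S, x ∈ G b) → x ∈ G a := by
    intro S a hS
    have := hGmax a (⋂ b ∈ S, G b) (.biInter S.to_countable fun b _ => hGm b)
      (hUnion.mono fun z hz => by
        obtain ⟨b, hb, hzb⟩ := mem_iUnion₂.1 (hS hz.1)
        exact mem_iUnion.2 ⟨b, hzb, mem_iInter₂.1 hz.2 b hb⟩)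
    filter_upwards [this] with x hx h
    exact hx (mem_iInter₂.2 h)
  let K : β → ℕ → Set β := fun a k =>
    {b | closure (U b) ⊆ U a ∧ ∀ u ∈ U b, ∀ v ∈ U b, dist u v ≤ 1 / ((k : ℝ) + 1)}
  have hK : ∀ a k, U a ⊆ ⋃ b ∈ K a k, U b := fun a k z hz => by
    obtain ⟨ε, hε, hεU⟩ := Metric.isOpen_iff.1 (hUo a) z hz
    have hk : (0 : ℝ) < 1 / ((k : ℝ) + 1) := by positivity
    obtain ⟨b, hzb, hb⟩ := hUb (Metric.isOpen_ball (x := z)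
      (ε := min (ε / 2) (1 / ((k : ℝ) + 1) / 2))) (Metric.mem_ball_self (by positivity))
    refine mem_iUnion₂.2 ⟨b, ⟨?_, fun u hu v hv => ?_⟩, hzb⟩
    · refine ((closure_mono hb).trans Metric.closure_ball_subset_closedBall).trans
        ((Metric.closedBall_subset_ball ?_).trans hεU)
      exact (min_le_left _ _).trans_lt (half_lt_self hε)
    · have hu' := (Metric.mem_ball.1 (hb hu)).trans_le (min_le_right _ _)
      have hv' := (Metric.mem_ball.1 (hb hv)).trans_le (min_le_right _ _)
      have := dist_triangle_right u v z
      linarith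
  have h3 : ∀ᵐ x ∂μ, ∀ a k, (∀ b ∈ K a k, x ∈ G b) → x ∈ G a :=
    ae_all_iff.2 fun a => ae_all_iff.2 fun k => h2 _ a (hK a k)
  have h4 : ∀ᵐ x ∂μ, ∀ a b, U a ⊆ U b → x ∈ G b → x ∈ G a := by
    refine ae_all_iff.2 fun a => ae_all_iff.2 fun b => ?_
    by_cases hab : U a ⊆ U b
    · filter_upwards [h2 {b} a (by simpa using hab)] with x hx _ hb
      exact hx (by simpa using hb)
    · exact .of_forall fun x h => absurd h hab
  let D : β → Set (β × β) := fun a => {q | U q.1 ⊆ U a ∧ U q.2 ⊆ U a ∧ Disjoint (U q.1) (U q.2)}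
  have h5 : ∀ᵐ x ∂μ, ∀ a, (∀ q ∈ D a, x ∈ G q.1 ∨ x ∈ G q.2) → x ∈ G a := by
    refine ae_all_iff.2 fun a => ?_
    let E : Set X := ⋂ q ∈ D a, G q.1 ∪ G q.2
    -- The points not yet covered by a labelled piece. Two of them in one fibre would lie in
    -- disjoint basic subsets of `U a`, one of which is labelled over their image; so `f` is
    -- injective on `Q`.
    let Q : Set Z := (U a ∩ f ⁻¹' E) \ ⋃ b, U b ∩ f ⁻¹' G b
    have hE : MeasurableSet E := .biInter (D a).to_countable fun q _ => (hGm q.1).union (hGm q.2)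
    have hUm : MeasurableSet (⋃ b, U b ∩ f ⁻¹' G b) :=
      .iUnion fun b => (hUo b).measurableSet.inter (hf.measurable (hGm b))
    have hQ : MeasurableSet Q := ((hUo a).measurableSet.inter (hf.measurable hE)).diff hUm
    have hQinj : InjOn f Q := by
      intro z hz z' hz' hzz
      by_contra hne
      obtain ⟨V, V', hV, hV', hzV, hzV', hd⟩ := t2_separation hne
      obtain ⟨b, hzb, hb⟩ := hUb (hV.inter (hUo a)) ⟨hzV, hz.1.1⟩
      obtain ⟨b', hzb', hb'⟩ := hUb (hV'.inter (hUo a)) ⟨hzV', hz'.1.1⟩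
      have hq : (b, b') ∈ D a := ⟨hb.trans inter_subset_right, hb'.trans inter_subset_right,
        hd.mono (hb.trans inter_subset_left) (hb'.trans inter_subset_left)⟩
      rcases mem_iInter₂.1 hz.1.2 _ hq with h | h
      · exact hz.2 (mem_iUnion.2 ⟨b, hzb, h⟩)
      · exact hz'.2 (mem_iUnion.2 ⟨b', hzb', by rw [mem_preimage, ← hzz]; exact h⟩)
    have hlab : HasFiberLabel μ f (U a ∩ f ⁻¹' E) := by
      refine (HasFiberLabel.iUnion (A := fun i : Bool => cond i Q (⋃ b, U b ∩ f ⁻¹' G b))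
        (fun i => ?_) fun i => ?_).mono fun z hz => ?_
      · cases i
        exacts [hUm, hQ]
      · cases i
        exacts [hUnion, hasFiberLabel_of_injOn hQinj]
      · by_cases hzU : z ∈ ⋃ b, U b ∩ f ⁻¹' G b
        · exact mem_iUnion.2 ⟨false, hzU⟩
        · exact mem_iUnion.2 ⟨true, hz, hzU⟩
    filter_upwards [hGmax a E hE hlab] with x hx h
    exact hx (mem_iInter₂.2 h)
  have key : ∀ᵐ x ∂μ, ∀ a, x ∈ G a := by
    filter_upwards [h1, h3, h4, h5] with x h1 h3 h4 h5
    -- The points with no basic neighbourhood labelled over `x`. This set is closed, lies in the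
    -- fibre of `x` by `h1`, meets every `U a` unlabelled over `x`, and has no isolated points by
    -- `h5`.
    let P : Set Z := {z | ∀ a, z ∈ U a → x ∉ G a}
    have hPclosed : IsClosed P := by
      have : P = ⋂ a ∈ {a | x ∈ G a}, (U a)ᶜ := by
        ext z
        simp only [P, mem_ofPred_eq, mem_iInter, mem_compl_iff]
        exact forall_congr' fun a => ⟨fun h h1 h2 => h h2 h1, fun h h1 h2 => h h2 h1⟩
      rw [this]
      exact isClosed_biInter fun a _ => (hUo a).isClosed_compl
    have hPfib : P ⊆ f ⁻¹' {x} := by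
      intro z hz
      by_contra hne
      obtain ⟨V, V', hV, hV', hzV, hxV, hd⟩ := t2_separation hne
      obtain ⟨a, hza, ha⟩ := hUb (hV.preimage hf) hzV
      refine hz a hza (h1 a fun hcl => ?_)
      obtain ⟨w, hw, v, hv, rfl⟩ := mem_closure_iff.1 hcl V' hV' hxV
      exact disjoint_left.1 hd (ha hv) hw
    have hPne : ∀ a, x ∉ G a → (U a ∩ P).Nonempty := by
      intro a ha
      have hstep : ∀ (b : {b // x ∉ G b}) (k : ℕ), ∃ c : {b // x ∉ G b}, c.1 ∈ K b.1 k := by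
        intro b k
        by_contra! hcon
        exact b.2 (h3 b.1 k fun c hc => by
          by_contra hxc
          exact hcon ⟨c, hxc⟩ hc)
      choose nx hnx using hstep
      -- Unlabelled basic sets, each with closure inside its predecessor, of diameters tending to
      -- zero. Every neighbourhood of their common point contains one of them, so by `h4` that point
      -- lies in `P`.
      let s : ℕ → {b // x ∉ G b} := fun n => Nat.rec ⟨a, ha⟩ (fun k b => nx b k) n
      have hs : ∀ n, (s (n + 1)).1 ∈ K (s n).1 n := fun n => hnx _ _
      have hanti : Antitone fun n => U (s n).1 :=
        antitone_nat_of_succ_le fun n => subset_closure.trans (hs n).1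
      have hne : ∀ n, (U (s n).1).Nonempty := fun n => by
        by_contra hemp
        rw [not_nonempty_iff_eq_empty] at hemp
        exact (s n).2 (h1 _ (by simp [hemp]))
      choose p hp using hne
      have hcau : CauchySeq fun n => p (n + 1) := by
        refine cauchySeq_of_le_tendsto_0 (fun n : ℕ => 1 / ((n : ℝ) + 1))
          (fun n m N hn hm => (hs N).2 _ ?_ _ ?_) tendsto_one_div_add_atTop_nhds_zero_nat
        · exact hanti (Nat.succ_le_succ hn) (hp (n + 1))
        · exact hanti (Nat.succ_le_succ hm) (hp (m + 1))
      obtain ⟨z, hz⟩ := cauchySeq_tendsto_of_complete hcau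
      have hzs : ∀ n, z ∈ U (s n).1 := fun n => (hs n).1 <|
        mem_closure_of_tendsto hz (eventually_atTop.2 ⟨n, fun m hm =>
          hanti (Nat.succ_le_succ hm) (hp (m + 1))⟩)
      refine ⟨z, hzs 0, fun b hzb hxb => ?_⟩
      obtain ⟨ε, hε, hεU⟩ := Metric.isOpen_iff.1 (hUo b) z hzb
      obtain ⟨n, hn⟩ := exists_nat_one_div_lt hε
      exact (s (n + 1)).2 (h4 _ b (fun v hv => hεU (Metric.mem_ball.2
        (((hs n).2 v hv z (hzs (n + 1))).trans_lt hn))) hxb)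
    have hPperf : Perfect P := by
      refine ⟨hPclosed, fun z hz => ?_⟩
      rw [accPt_iff_nhds]
      intro V hV
      obtain ⟨V', hV'V, hV', hzV'⟩ := mem_nhds_iff.1 hV
      obtain ⟨a, hza, ha⟩ := hUb hV' hzV'
      have hxa := hz a hza
      have : ∃ q ∈ D a, x ∉ G q.1 ∧ x ∉ G q.2 := by
        by_contra! hcon
        exact hxa (h5 a fun q hq => or_iff_not_imp_left.2 fun h => by
          by_contra h'
          exact h' (by simpa using hcon q hq h))
      obtain ⟨q, hq, hq1, hq2⟩ := this
      obtain ⟨y1, hy1, hy1P⟩ := hPne _ hq1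
      obtain ⟨y2, hy2, hy2P⟩ := hPne _ hq2
      by_cases h : y1 = z
      · refine ⟨y2, ⟨hV'V (ha (hq.2.1 hy2)), hy2P⟩, fun h' => ?_⟩
        exact disjoint_left.1 hq.2.2 hy1 (h ▸ h' ▸ hy2)
      · exact ⟨y1, ⟨hV'V (ha (hq.1 hy1)), hy1P⟩, h⟩
    intro a
    by_contra ha
    obtain ⟨z, -, hz⟩ := hPne a ha
    obtain ⟨g, hg, -, hginj⟩ := hPperf.exists_nat_bool_injection ⟨z, hz⟩
    have : Countable (ℕ → Bool) := countable_univ_iff.1 <|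
      (MapsTo.countable_of_injOn (fun b _ => hPfib (hg (mem_range_self b)))
        hginj.injOn (hc x))
    obtain ⟨e, he⟩ := exists_surjective_nat (ℕ → Bool)
    obtain ⟨n, hn⟩ := he fun n => !(e n n)
    simpa using congrFun hn n
  obtain ⟨l, hl, hinj⟩ := hUnion
  refine ⟨l, hl, ?_⟩
  filter_upwards [key, hinj] with x hx hlx
  refine hlx.mono fun z (hz : z ∈ univ ∩ f ⁻¹' {x}) => mem_inter ?_ hz.2
  obtain ⟨a, hza, -⟩ := hUb isOpen_univ (mem_univ z)
  exact mem_iUnion.2 ⟨a, hza, by rw [mem_preimage, show f z = x from hz.2]; exact hx a⟩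

/-- A measure-theoretic Lusin–Novikov theorem: the points of almost every fibre of a
countable-to-one Borel map can be labelled injectively by natural numbers, in a Borel way. -/
theorem exists_measurable_fiber_label {Z X : Type*} [MeasurableSpace Z] [StandardBorelSpace Z]
    [MeasurableSpace X] [StandardBorelSpace X] (μ : Measure X) [IsFiniteMeasure μ] {f : Z → X}
    (hf : Measurable f) (hc : ∀ x, (f ⁻¹' {x}).Countable) :
    ∃ l : Z → ℕ, Measurable l ∧ ∀ᵐ x ∂μ, InjOn l (f ⁻¹' {x}) := by
  let := upgradeStandardBorel X
  let tZ := upgradeStandardBorel Z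
  -- A finer Polish topology makes `f` continuous without changing the Borel sets.
  obtain ⟨t', ht', hcont, hpol⟩ := hf.exists_continuous
  have hb : @BorelSpace Z t' _ :=
    ⟨(@BorelSpace.measurable_eq Z tZ.toTopologicalSpace _ _).trans
      (@borel_eq_borel_of_le Z t' tZ.toTopologicalSpace hpol inferInstance ht').symm⟩
  obtain ⟨l, hl, h⟩ := @hasFiberLabel_of_continuous Z X t' hpol _ hb _ _ _ _ μ _ f hcont hc
  exact ⟨l, hl, by simpa using h⟩

/-- Almost every fibre of a Borel equivalence relation with countable classes is enumerated by a
sequence of Borel maps. -/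
theorem DiscreteBorelEquivRel.exists_enumeration {X : Type u} [MeasurableSpace X]
    [StandardBorelSpace X] (μ : Measure X) [IsFiniteMeasure μ] (R : DiscreteBorelEquivRel X) :
    ∃ g : ℕ → X → X, (∀ n, Measurable (g n)) ∧ (∀ n x, R.r x (g n x)) ∧
      ∀ᵐ x ∂μ, ∀ y, R.r x y → ∃ n, g n x = y := by
  classical
  let Z := {p : X × X // R.r p.1 p.2}
  have : StandardBorelSpace Z := R.measurableSet_graph.standardBorel
  have hfst : Measurable fun p : Z => p.1.1 := measurable_subtype_coe.fst
  have hsnd : Measurable fun p : Z => p.1.2 := measurable_subtype_coe.snd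
  have hc : ∀ x, ((fun p : Z => p.1.1) ⁻¹' {x}).Countable := fun x => by
    refine MapsTo.countable_of_injOn (t := {y | R.r x y}) (f := fun p : Z => p.1.2) ?_ ?_
      (R.countable_class x)
    · rintro ⟨⟨a, b⟩, h⟩ rfl
      exact h
    · rintro ⟨⟨a, b⟩, h⟩ rfl ⟨⟨c, d⟩, h'⟩ h1 h2
      exact Subtype.ext (Prod.ext (show c = a from h1).symm h2)
  obtain ⟨l, hl, hinj⟩ := exists_measurable_fiber_label μ hfst hc
  obtain ⟨N, hN, hNm, hN0⟩ := exists_measurable_superset_of_null (ae_iff.1 hinj)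
  have hN' : ∀ x ∉ N, InjOn l ((fun p : Z => p.1.1) ⁻¹' {x}) := fun x hx => by
    by_contra h
    exact hx (hN h)
  have hstep : ∀ n, ∃ g : X → X, Measurable g ∧ (∀ x, R.r x (g x)) ∧
      ∀ p : Z, p.1.1 ∉ N → l p = n → g p.1.1 = p.1.2 := by
    intro n
    -- The pairs with label `n` form a Borel set with injective first projection, so they are the
    -- graph of a Borel function on a Borel set. Elsewhere `g x = x`, to remain in the class.
    let A : Set Z := {p | p.1.1 ∉ N ∧ l p = n}
    have hA : MeasurableSet A := (hfst hNm).compl.inter (hl (measurableSet_singleton n))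
    have : StandardBorelSpace A := hA.standardBorel
    have hem : MeasurableEmbedding fun p : A => p.1.1.1 := by
      refine (hfst.comp measurable_subtype_coe).measurableEmbedding ?_
      rintro ⟨p, hp, hp'⟩ ⟨q, hq, hq'⟩ h
      exact Subtype.ext (hN' p.1.1 hp rfl (show q.1.1 = p.1.1 from h.symm) (hp'.trans hq'.symm))
    rcases isEmpty_or_nonempty X with hX | hX
    · exact ⟨id, measurable_id, fun x => R.iseqv.refl x, fun p => hX.elim p.1.1⟩
    obtain ⟨h, hh, heq⟩ := hem.exists_measurable_extend (hsnd.comp measurable_subtype_coe)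
      fun _ => hX
    refine ⟨fun x => if x ∈ range fun p : A => p.1.1.1 then h x else x,
      Measurable.ite hem.measurableSet_range hh measurable_id, fun x => ?_, fun p hp hpn => ?_⟩
    · dsimp only
      split_ifs with hx
      · obtain ⟨p, rfl⟩ := hx
        rw [show h p.1.1.1 = p.1.1.2 from congrFun heq p]
        exact p.1.2
      · exact R.iseqv.refl x
    · have hmem : p.1.1 ∈ range fun p : A => p.1.1.1 := ⟨⟨p, hp, hpn⟩, rfl⟩
      dsimp only
      rw [if_pos hmem]
      exact congrFun heq ⟨p, hp, hpn⟩
  choose g hg hgR hgl using hstep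
  refine ⟨g, hg, hgR, ?_⟩
  filter_upwards [measure_eq_zero_iff_ae_notMem.1 hN0] with x hx y hxy
  exact ⟨_, hgl _ ⟨(x, y), hxy⟩ hx rfl⟩

end LusinNovikov

/-! ### Borel dependence of minima, enumerations and cardinalities of sets of naturals. -/

section CountingMeasurability

variable {X : Type*} [MeasurableSpace X] {K : X → Set ℕ}

theorem measurable_sInf_nat (hK : ∀ n, MeasurableSet {x | n ∈ K x}) :
    Measurable fun x => sInf (K x) := by
  refine measurable_to_countable' fun n => ?_
  -- The second set is there because `sInf ∅ = 0`.
  have : (fun x => sInf (K x)) ⁻¹' {n} =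
      ({x | n ∈ K x} ∩ ⋂ m, ⋂ (_ : m < n), {x | m ∈ K x}ᶜ) ∪
        ({_x | n = 0} ∩ ⋂ m, {x | m ∈ K x}ᶜ) := by
    ext x
    simp only [mem_preimage, mem_singleton_iff, mem_union, mem_inter_iff, mem_ofPred_eq, mem_iInter,
      mem_compl_iff]
    constructor
    · rintro rfl
      rcases (K x).eq_empty_or_nonempty with h | h
      · exact .inr (by simp [h])
      · exact .inl ⟨Nat.sInf_mem h, fun m hm => Nat.notMem_of_lt_sInf hm⟩
    · rintro (⟨h, h'⟩ | ⟨rfl, h⟩)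
      · refine le_antisymm (Nat.sInf_le h) (not_lt.1 fun hlt => h' _ hlt (Nat.sInf_mem ⟨n, h⟩))
      · rw [eq_empty_of_forall_notMem h, Nat.sInf_empty]
  rw [this]
  exact ((hK n).inter (.iInter fun m => .iInter fun _ => (hK m).compl)).union
    ((MeasurableSet.const _).inter (.iInter fun m => (hK m).compl))

theorem measurable_nat_nth (hK : ∀ n, MeasurableSet {x | n ∈ K x}) (j : ℕ) :
    Measurable fun x => Nat.nth (· ∈ K x) j := by
  induction j using Nat.strong_induction_on with
  | _ j ih =>
    simp only [Nat.nth_eq_sInf _ j]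
    refine measurable_sInf_nat (K := fun x => {n | n ∈ K x ∧ ∀ k < j, Nat.nth (· ∈ K x) k < n})
      fun n => ?_
    have : {x | n ∈ {n | n ∈ K x ∧ ∀ k < j, Nat.nth (· ∈ K x) k < n}} =
        {x | n ∈ K x} ∩ ⋂ k, ⋂ (_ : k < j), {x | Nat.nth (· ∈ K x) k < n} := by
      ext x; simp
    rw [this]
    exact (hK n).inter (.iInter fun k => .iInter fun hk =>
      measurableSet_lt (ih k hk) measurable_const)

theorem measurableSet_encard_eq (hK : ∀ n, MeasurableSet {x | n ∈ K x}) (c : ℕ∞) :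
    MeasurableSet {x | (K x).encard = c} := by
  have hle : ∀ k : ℕ, MeasurableSet {x | (k : ℕ∞) ≤ (K x).encard} := fun k => by
    have : {x | (k : ℕ∞) ≤ (K x).encard} =
        ⋃ s : Finset ℕ, ⋃ (_ : s.card = k), ⋂ n ∈ s, {x | n ∈ K x} := by
      ext x
      simp only [mem_ofPred_eq, mem_iUnion, mem_iInter, exists_prop]
      constructor
      · intro h
        obtain ⟨t, ht, htk⟩ := exists_subset_encard_eq h
        have hfin : t.Finite := finite_of_encard_eq_coe htk
        refine ⟨hfin.toFinset, ?_, fun n hn => ht (hfin.mem_toFinset.1 hn)⟩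
        rw [hfin.encard_eq_coe_toFinset_card] at htk
        exact_mod_cast htk
      · rintro ⟨s, rfl, hs⟩
        rw [← encard_coe_eq_coe_finsetCard]
        exact encard_le_encard hs
    rw [this]
    exact .iUnion fun s => .iUnion fun _ => .biInter s.countable_toSet fun n _ => hK n
  induction c using ENat.recTopCoe with
  | top =>
    have : {x | (K x).encard = ⊤} = ⋂ k : ℕ, {x | (k : ℕ∞) ≤ (K x).encard} := by
      ext x
      simp only [mem_ofPred_eq, mem_iInter]
      exact ⟨fun h k => h ▸ le_top, fun h => ENat.eq_top_iff_forall_ge.2 h⟩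
    rw [this]
    exact .iInter hle
  | coe n =>
    have : {x | (K x).encard = n} =
        {x | (n : ℕ∞) ≤ (K x).encard} \ {x | ((n + 1 : ℕ) : ℕ∞) ≤ (K x).encard} := by
      ext x
      simp only [mem_ofPred_eq, Set.mem_sdiff, Nat.cast_add, Nat.cast_one, not_le]
      rw [ENat.lt_add_one_iff (ENat.natCast_ne_top n)]
      exact ⟨fun h => ⟨h.ge, h.le⟩, fun h => le_antisymm h.2 h.1⟩
    rw [this]
    exact (hle n).diff (hle _)

end CountingMeasurability

/-! ### Increasing enumeration of an `N`-element set of naturals by `IndexSet N`. -/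

section Nth

variable {K : Set ℕ} {N : ℕ∞}

theorem IndexSet.lt_card (h : K.encard = N) (j : IndexSet N) (hf : (Set.ofPred (· ∈ K)).Finite) :
    j.1 < hf.toFinset.card := by
  have h1 : (j.1 : ℕ∞) < K.encard := h ▸ j.2
  rw [show K.encard = _ from hf.encard_eq_coe_toFinset_card] at h1
  exact_mod_cast h1

theorem nth_mem_of_encard (h : K.encard = N) (j : IndexSet N) : Nat.nth (· ∈ K) j.1 ∈ K :=
  Nat.nth_mem (p := (· ∈ K)) _ (IndexSet.lt_card h j)

theorem count_nth_of_encard [DecidablePred (· ∈ K)] (h : K.encard = N) (j : IndexSet N) :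
    Nat.count (· ∈ K) (Nat.nth (· ∈ K) j.1) = j.1 :=
  Nat.count_nth (IndexSet.lt_card h j)

theorem count_lt_of_encard [DecidablePred (· ∈ K)] (h : K.encard = N) {n : ℕ} (hn : n ∈ K) :
    (Nat.count (· ∈ K) n : ℕ∞) < N := by
  rw [← h]
  by_cases hf : K.Finite
  · rw [hf.encard_eq_coe_toFinset_card]
    exact_mod_cast Nat.count_lt_card (p := (· ∈ K)) hf hn
  · rw [encard_eq_top (show K.Infinite from hf)]
    exact ENat.natCast_lt_top _

end Nth

/-! ### Null sets, invariant sets, ergodicity, and existence of choice functions. -/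

section Relations

/-- Comparing with the indicator of `B` avoids any measurability of the fibre counts. -/
theorem ae_notMem_of_lintegral_encard_eq_zero {Y α : Type*} [MeasurableSpace Y] {ν : Measure Y}
    {B : Set Y} (hB : MeasurableSet B) {s : Y → Set α} (hs : ∀ y ∈ B, (s y).Nonempty)
    (h : ∫⁻ y, ((s y).encard : ℝ≥0∞) ∂ν = 0) : ∀ᵐ y ∂ν, y ∉ B := by
  rw [← measure_eq_zero_iff_ae_notMem, ← le_zero_iff, ← h, ← lintegral_indicator_one hB]
  refine lintegral_mono fun y => ?_
  by_cases hy : y ∈ B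
  · rw [indicator_of_mem hy]
    exact (by exact_mod_cast one_le_encard_iff_nonempty.2 (hs y hy) :
      (1 : ℝ≥0∞) ≤ (ENat.toENNReal _))
  · rw [indicator_of_notMem hy]
    exact zero_le

theorem lintegral_encard_eq_zero_iff {Y α : Type*} [MeasurableSpace Y] {ν : Measure Y}
    {B : Set Y} (hB : MeasurableSet B) {s : Y → Set α} (hs : ∀ y, (s y).Nonempty ↔ y ∈ B) :
    ∫⁻ y, ((s y).encard : ℝ≥0∞) ∂ν = 0 ↔ ∀ᵐ y ∂ν, y ∉ B := by
  refine ⟨ae_notMem_of_lintegral_encard_eq_zero hB fun y => (hs y).2, fun h =>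
    lintegral_eq_zero_of_ae_eq_zero ?_⟩
  filter_upwards [h] with y hy
  rw [not_nonempty_iff_eq_empty.1 fun hne => hy ((hs y).1 hne)]
  simp

variable {X : Type u} [MeasurableSpace X]

theorem DiscreteBorelEquivRel.measurableSet_rel (S : DiscreteBorelEquivRel X) {Y : Type*}
    [MeasurableSpace Y] {f g : Y → X} (hf : Measurable f) (hg : Measurable g) :
    MeasurableSet {y | S.r (f y) (g y)} :=
  (hf.prodMk hg) S.measurableSet_graph

/-- A conull Borel union of `R`-classes. -/
structure IsConullInvariant (μ : Measure X) (R : DiscreteBorelEquivRel X) (A : Set X) : Prop where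
  measurableSet : MeasurableSet A
  mem_iff : ∀ {x y}, R.r x y → (x ∈ A ↔ y ∈ A)
  ae_mem : ∀ᵐ x ∂μ, x ∈ A

variable [StandardBorelSpace X] {μ : Measure X} {R : DiscreteBorelEquivRel X}

/-- The pairs whose second coordinate lies in a null set are null for the right mass, hence for the
left mass, so almost no class meets that null set. The enumeration provides the Borel set to which
this is applied. -/
theorem ae_forall_rel [IsFiniteMeasure μ] (hq : R.toGroupoid.QuasiInvariant μ) {P : X → Prop}
    (h : ∀ᵐ x ∂μ, P x) : ∀ᵐ x ∂μ, ∀ y, R.r x y → P y := by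
  obtain ⟨N, hN, hNm, hN0⟩ := exists_measurable_superset_of_null (ae_iff.1 h)
  obtain ⟨g, hg, hgR, hge⟩ := R.exists_enumeration μ
  let A : Set {p : X × X // R.r p.1 p.2} := {p | p.1.2 ∈ N}
  have hA : MeasurableSet A := measurable_subtype_coe.snd hNm
  have hr : R.toGroupoid.rightMass μ A = 0 := by
    refine (lintegral_encard_eq_zero_iff hNm fun y => ?_).2
      (measure_eq_zero_iff_ae_notMem.1 hN0)
    exact ⟨fun ⟨p, hp, hpy⟩ => hpy ▸ hp, fun hy => ⟨⟨(y, y), R.iseqv.refl y⟩, hy, rfl⟩⟩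
  have hB : MeasurableSet (⋃ n, g n ⁻¹' N) := .iUnion fun n => hg n hNm
  have hB0 : ∀ᵐ x ∂μ, x ∉ ⋃ n, g n ⁻¹' N := by
    refine ae_notMem_of_lintegral_encard_eq_zero hB (fun x hx => ?_) ((hq A hA).2 hr)
    obtain ⟨n, hn⟩ := mem_iUnion.1 hx
    exact ⟨⟨(x, g n x), hgR n x⟩, hn, rfl⟩
  filter_upwards [hge, hB0] with x hx hxB y hxy
  obtain ⟨n, rfl⟩ := hx y hxy
  by_contra hP
  exact hxB (mem_iUnion.2 ⟨n, hN hP⟩)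

theorem exists_isConullInvariant [IsFiniteMeasure μ] (hq : R.toGroupoid.QuasiInvariant μ)
    {P : X → Prop} (h : ∀ᵐ x ∂μ, P x) : ∃ A, IsConullInvariant μ R A ∧ ∀ x ∈ A, P x := by
  obtain ⟨g, hg, hgR, hge⟩ := R.exists_enumeration μ
  obtain ⟨N, hN, hNm, hN0⟩ := exists_measurable_superset_of_null (ae_iff.1 (h.and hge))
  have hN' : ∀ x ∉ N, P x ∧ ∀ y, R.r x y → ∃ n, g n x = y := fun x hx => by
    by_contra hc
    exact hx (hN hc)
  -- Off `N` the enumeration exhausts the class, so `A` consists of the points whose whole class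
  -- avoids `N`.
  let A : Set X := Nᶜ ∩ ⋂ n, g n ⁻¹' Nᶜ
  have hinv : ∀ x y, R.r x y → x ∈ A → y ∈ A := by
    intro x y hxy hx
    have hcl : ∀ z, R.r x z → z ∉ N := fun z hz => by
      obtain ⟨n, rfl⟩ := (hN' x hx.1).2 z hz
      exact mem_iInter.1 hx.2 n
    exact ⟨hcl y hxy, mem_iInter.2 fun n => hcl _ (R.iseqv.trans hxy (hgR n y))⟩
  refine ⟨A, ⟨hNm.compl.inter (.iInter fun n => hg n hNm.compl), fun hxy =>
    ⟨hinv _ _ hxy, hinv _ _ (R.iseqv.symm hxy)⟩, ?_⟩, fun x hx => (hN' x hx.1).1⟩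
  filter_upwards [ae_forall_rel hq (measure_eq_zero_iff_ae_notMem.1 hN0)] with x hx
  exact ⟨hx x (R.iseqv.refl x), mem_iInter.2 fun n => hx _ (hgR n x)⟩

/-- An invariant function with countably many values is constant almost everywhere. -/
theorem exists_ae_eq_const [IsProbabilityMeasure μ] (he : R.toGroupoid.Ergodic μ) {C : Type*}
    [Countable C] {f : X → C} {A : Set X} (hA : IsConullInvariant μ R A)
    (hf : ∀ c, MeasurableSet {x | f x = c}) (hinv : ∀ x ∈ A, ∀ y, R.r x y → f x = f y) :
    ∃ c, ∀ᵐ x ∂μ, f x = c := by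
  by_contra! hc
  have h0 : ∀ c, μ (A ∩ {x | f x = c}) = 0 := fun c => by
    refine (he _ (hA.measurableSet.inter (hf c)) ?_).resolve_right fun h1 => hc c ?_
    · rintro ⟨⟨x, y⟩, hxy⟩
      have key : ∀ x y, R.r x y → x ∈ A ∩ {x | f x = c} → y ∈ A ∩ {x | f x = c} :=
        fun x y hxy hx => ⟨(hA.mem_iff hxy).1 hx.1, (hinv x hx.1 y hxy).symm.trans hx.2⟩
      exact ⟨key y x (R.iseqv.symm hxy), key x y hxy⟩
    · filter_upwards [(mem_ae_iff_prob_eq_one (hA.measurableSet.inter (hf c))).2 h1] with x hx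
      exact not_not.2 hx.2
  have : μ univ = 0 := by
    have hU : μ (⋃ c, A ∩ {x | f x = c}) = 0 := measure_iUnion_null h0
    rw [← inter_iUnion] at hU
    refine measure_mono_null (t := Aᶜ ∪ A ∩ ⋃ c, {x | f x = c}) (fun x _ => ?_)
      (measure_union_null (mem_ae_iff.1 hA.ae_mem) hU)
    by_cases hx : x ∈ A
    · exact .inr ⟨hx, mem_iUnion.2 ⟨f x, rfl⟩⟩
    · exact .inl hx
  simp at this

/-- In the enumeration of the class of `x`, only the first member of each `S`-class is kept. The
number of kept points is invariant, hence almost everywhere a constant `N` by ergodicity, and the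
`j`-th choice function selects the `j`-th kept point. -/
theorem exists_isChoiceFamily [IsProbabilityMeasure μ] (hq : R.toGroupoid.QuasiInvariant μ)
    (he : R.toGroupoid.Ergodic μ) (S : DiscreteBorelEquivRel X) :
    ∃ (N : ℕ∞) (φ : IndexSet N → X → X), IsChoiceFamily μ R S φ := by
  classical
  obtain ⟨g, hg, hgR, hge⟩ := R.exists_enumeration μ
  obtain ⟨A, hA, hAg⟩ := exists_isConullInvariant hq hge
  let K : X → Set ℕ := fun x => {n | ∀ m < n, ¬ S.r (g m x) (g n x)}
  have hK : ∀ n, MeasurableSet {x | n ∈ K x} := fun n => by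
    have : {x | n ∈ K x} = ⋂ m, ⋂ (_ : m < n), {x | S.r (g m x) (g n x)}ᶜ := by
      ext x; simp [K]
    rw [this]
    exact .iInter fun m => .iInter fun _ => (S.measurableSet_rel (hg m) (hg n)).compl
  have hfirst : ∀ x ∈ A, ∀ z, R.r x z → ∃ n ∈ K x, S.r (g n x) z := by
    intro x hx z hz
    have hex : ∃ n, S.r (g n x) z := by
      obtain ⟨n, rfl⟩ := hAg x hx z hz
      exact ⟨n, S.iseqv.refl _⟩
    exact ⟨Nat.find hex, fun m hm h => Nat.find_min hex hm (S.iseqv.trans h (Nat.find_spec hex)),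
      Nat.find_spec hex⟩
  have hKinj : ∀ x n m, n ∈ K x → m ∈ K x → S.r (g n x) (g m x) → n = m := by
    intro x n m hn hm h
    rcases lt_trichotomy n m with hlt | heq | hgt
    exacts [absurd h (hm n hlt), heq, absurd (S.iseqv.symm h) (hn m hgt)]
  have hle : ∀ x ∈ A, ∀ y, R.r x y → (K x).encard ≤ (K y).encard := by
    intro x hx y hxy
    have hy := (hA.mem_iff hxy).1 hx
    choose! t htK ht using fun n => hfirst y hy (g n x) (R.iseqv.trans (R.iseqv.symm hxy) (hgR n x))
    refine encard_le_encard_of_injOn (f := t) (fun n _ => htK n) fun n hn m hm hnm => ?_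
    refine hKinj x n m hn hm (S.iseqv.trans (S.iseqv.symm (ht n)) ?_)
    rw [hnm]
    exact ht m
  obtain ⟨N, hN⟩ := exists_ae_eq_const he hA (measurableSet_encard_eq hK) fun x hx y hxy =>
    (hle x hx y hxy).antisymm (hle y ((hA.mem_iff hxy).1 hx) x (R.iseqv.symm hxy))
  refine ⟨N, fun j x => g (Nat.nth (· ∈ K x) j.1) x, fun j => ?_,
    .of_forall fun x j => hgR _ x, ?_⟩
  · exact (measurable_from_prod_countable_right (f := fun q : ℕ × X => g q.1 q.2) hg).comp
      ((measurable_nat_nth hK j.1).prodMk measurable_id)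
  · filter_upwards [hN, hA.ae_mem] with x hxN hxA y hxy
    obtain ⟨n, hn, hny⟩ := hfirst x hxA y hxy
    refine ⟨⟨Nat.count (· ∈ K x) n, count_lt_of_encard hxN hn⟩, ?_, fun j hj => ?_⟩
    · dsimp only
      rwa [Nat.nth_count (p := (· ∈ K x)) hn]
    · have := hKinj x _ n (nth_mem_of_encard hxN j) hn (S.iseqv.trans hj (S.iseqv.symm hny))
      refine Subtype.ext ?_
      have h2 := count_nth_of_encard hxN j
      rw [this] at h2
      exact h2.symm

end Relations

/-! ### Choice families and their index cocycle. -/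

section ChoiceFamilies

variable {X : Type u} [MeasurableSpace X] {R S : DiscreteBorelEquivRel X} {N : ℕ∞}
  {φ : IndexSet N → X → X} {μ : Measure X}

/-- The conditions on a choice family at a single point. -/
def IsChoiceAt (R S : DiscreteBorelEquivRel X) (φ : IndexSet N → X → X) (x : X) : Prop :=
  (∀ j, R.r x (φ j x)) ∧ ∀ y, R.r x y → ∃! j, S.r (φ j x) y

theorem IsChoiceFamily.ae_isChoiceAt (h : IsChoiceFamily μ R S φ) :
    ∀ᵐ x ∂μ, IsChoiceAt R S φ x :=
  h.rel.and h.partition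

theorem IsChoiceAt.eq {x : X} (hx : IsChoiceAt R S φ x) {i j : IndexSet N} {z : X}
    (hi : S.r (φ i x) z) (hj : S.r (φ j x) z) : i = j :=
  (hx.2 _ (hx.1 j)).unique (S.iseqv.trans hi (S.iseqv.symm hj)) (S.iseqv.refl _)

/-- Exchanging `x` and `y` produces the inverse index map, so the required permutation exists and
the default value `1` of `indexCocycle` does not occur. -/
theorem IsChoiceAt.rel_indexCocycle {x y : X} (hx : IsChoiceAt R S φ x)
    (hy : IsChoiceAt R S φ y) (hxy : R.r x y) (i : IndexSet N) :
    S.r (φ (indexCocycle S φ x y i) x) (φ i y) := by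
  have key : ∀ {x y}, IsChoiceAt R S φ x → IsChoiceAt R S φ y → R.r x y → ∀ i, ∃ j,
      S.r (φ j x) (φ i y) :=
    fun {x y} hx hy hxy i => (hx.2 _ (R.iseqv.trans hxy (hy.1 i))).exists
  choose p hp using key hx hy hxy
  choose q hq using key hy hx (R.iseqv.symm hxy)
  have hex : ∃ p : Equiv.Perm (IndexSet N), ∀ i, S.r (φ (p i) x) (φ i y) :=
    ⟨⟨p, q, fun i => hy.eq (hq (p i)) (S.iseqv.symm (hp i)),
      fun j => hx.eq (hp (q j)) (S.iseqv.symm (hq j))⟩, hp⟩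
  rw [indexCocycle, dif_pos hex]
  exact hex.choose_spec i

theorem encard_range_of_injective {f : IndexSet N → ℕ} (hf : Function.Injective f) :
    (range f).encard = N := by
  rw [← image_univ, hf.encard_image, ← Subtype.val_injective.encard_image, image_univ,
    Subtype.range_coe_subtype]
  induction N using ENat.recTopCoe with
  | top => simp
  | coe n =>
    have : {j : ℕ | (j : ℕ∞) < n} = (Finset.range n : Set ℕ) := by
      ext j; simp
    rw [this, encard_coe_eq_coe_finsetCard, Finset.card_range]

variable [StandardBorelSpace X] [IsFiniteMeasure μ]

/-- Borel labels of `J` over `X` that are transported by a cocycle trivialize the cocycle. -/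
theorem isCoboundaryOn_of_label (hq : R.toGroupoid.QuasiInvariant μ)
    (hSR : ∀ x y, S.r x y → R.r x y) {σ : X → X → Equiv.Perm (IndexSet N)}
    (L : IndexSet N → X → ℕ) (hL : ∀ k, Measurable (L k))
    (hinj : ∀ᵐ x ∂μ, Function.Injective fun k => L k x)
    (hinv : ∀ᵐ x ∂μ, ∀ y, S.r x y → ∀ k, L (σ x y k) x = L k y) : IsCoboundaryOn μ S σ := by
  classical
  let K : X → Set ℕ := fun x => range fun k => L k x
  have hK : ∀ n, MeasurableSet {x | n ∈ K x} := fun n => by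
    have : {x | n ∈ K x} = ⋃ k, L k ⁻¹' {n} := by
      ext x; simp [K]
    rw [this]
    exact .iUnion fun k => hL k (measurableSet_singleton n)
  -- `ψ x t` will be the index carrying the `t`-th smallest label at `x`. Transport makes `K`
  -- constant along `S`, so `σ x y * ψ y` and `ψ x` both send `t` to the index whose label at `x` is
  -- the `t`-th element of `K x`.
  have hr : ∀ x, Function.Injective (fun k => L k x) → ∃ p : Equiv.Perm (IndexSet N),
      ∀ t, L (p t) x = Nat.nth (· ∈ K x) t.1 := by
    intro x hx
    have hc := encard_range_of_injective hx
    choose f hf using fun t : IndexSet N => nth_mem_of_encard hc t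
    refine ⟨Equiv.ofBijective f ⟨fun s t hst => Subtype.ext ?_, fun k => ?_⟩, hf⟩
    · rw [← count_nth_of_encard hc s, ← count_nth_of_encard hc t, ← hf s, ← hf t, hst]
    · have hk : L k x ∈ K x := mem_range_self k
      refine ⟨⟨_, count_lt_of_encard hc hk⟩, hx ?_⟩
      exact (hf _).trans (Nat.nth_count (p := (· ∈ K x)) hk)
  choose! ψ hψ using hr
  let ψ' : X → Equiv.Perm (IndexSet N) := fun x =>
    if Function.Injective (fun k => L k x) then ψ x else 1
  have hm : MeasurableSet {x | Function.Injective fun k => L k x} := by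
    have : {x | Function.Injective fun k => L k x} =
        ⋂ k, ⋂ l, ⋂ (_ : k ≠ l), {x | L k x = L l x}ᶜ := by
      ext x
      simp only [mem_ofPred_eq, mem_iInter, mem_compl_iff]
      exact ⟨fun h k l hkl e => hkl (h e), fun h k l e => by_contra fun hkl => h k l hkl e⟩
    rw [this]
    exact .iInter fun k => .iInter fun l => .iInter fun _ =>
      (measurableSet_eq_fun (hL k) (hL l)).compl
  refine ⟨ψ', fun t => measurable_to_countable' fun k => ?_, ?_⟩
  · have : (fun x => ψ' x t) ⁻¹' {k} =
        {x | Function.Injective fun k => L k x}.ite {x | L k x = Nat.nth (· ∈ K x) t.1}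
          {_x | t = k} := by
      ext x
      by_cases hx : Function.Injective fun k => L k x
      · simp only [mem_preimage, mem_singleton_iff, ψ', Set.ite, mem_union,
          mem_inter_iff, mem_ofPred_eq, hx, and_true, Set.mem_sdiff, not_true, and_false, or_false]
        exact ⟨fun h => h ▸ hψ x hx t, fun h => hx ((hψ x hx t).trans h.symm)⟩
      · simp [ψ', hx, Set.ite]
    rw [this]
    exact hm.ite (measurableSet_eq_fun (hL k) (measurable_nat_nth hK _)) (.const _)
  · filter_upwards [ae_forall_rel hq hinj, hinv] with x hx hxi y hxy
    have h1 := hx x (R.iseqv.refl x)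
    have h2 := hx y (hSR x y hxy)
    have hKxy : K x = K y := by
      ext n
      constructor
      · rintro ⟨k, rfl⟩
        refine ⟨(σ x y).symm k, ?_⟩
        simpa using (hxi y hxy ((σ x y).symm k)).symm
      · rintro ⟨k, rfl⟩
        exact ⟨σ x y k, hxi y hxy k⟩
    rw [eq_mul_inv_iff_mul_eq]
    ext1 t
    simp only [ψ', if_pos h1, if_pos h2, Equiv.Perm.mul_apply]
    refine h1 ?_
    dsimp only
    rw [hxi y hxy, hψ x h1, hψ y h2, hKxy]

/-- The family is reindexed by `ψ`: over `S` the cocycle takes `ψ y j` to `ψ x j`, which says that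
the reindexed choices at `x` and `y` are `S`-equivalent. -/
theorem exists_endomorphisms_of_isCoboundaryOn (hq : R.toGroupoid.QuasiInvariant μ)
    (hSR : ∀ x y, S.r x y → R.r x y) (hφ : IsChoiceFamily μ R S φ)
    (h : IsCoboundaryOn μ S (indexCocycle S φ)) :
    ∃ φ' : IndexSet N → X → X, IsChoiceFamily μ R S φ' ∧ ∀ j, IsEndomorphism μ S (φ' j) := by
  obtain ⟨ψ, hψ, hψσ⟩ := h
  refine ⟨fun j x => φ (ψ x j) x, ⟨fun j => ?_, hφ.rel.mono fun x hx j => hx _, ?_⟩, fun j => ?_⟩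
  · exact (measurable_from_prod_countable_right (f := fun q : IndexSet N × X => φ q.1 q.2)
      hφ.measurable).comp ((hψ j).prodMk measurable_id)
  · filter_upwards [hφ.partition] with x hx y hxy
    obtain ⟨j, hj, hju⟩ := hx y hxy
    exact ⟨(ψ x).symm j, by simpa using hj, fun i hi => by simp [← hju _ hi]⟩
  · filter_upwards [ae_forall_rel hq hφ.ae_isChoiceAt, hψσ] with x hx hxσ y hxy
    have := (hx x (R.iseqv.refl x)).rel_indexCocycle (hx y (hSR x y hxy)) (hSR x y hxy) (ψ y j)
    simpa [hxσ y hxy] using this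

end ChoiceFamilies

/-! ### Coboundaries and Zimmer's unitary criterion. -/

section Zimmer

/-- The unitary operator of a permutation of an orthonormal basis. -/
noncomputable def permUnitary {J : Type*} (p : Equiv.Perm J) :
    lp (fun _ : J => ℂ) 2 ≃ₗᵢ[ℂ] lp (fun _ : J => ℂ) 2 where
  toFun v := ⟨fun k => v (p.symm k), by
    refine (memℓp_gen_iff (by norm_num)).2 ?_
    exact (p.symm.summable_iff (f := fun k => ‖v k‖ ^ (2 : ℝ≥0∞).toReal)).2
      ((memℓp_gen_iff (by norm_num)).1 (lp.memℓp v))⟩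
  invFun v := ⟨fun k => v (p k), by
    refine (memℓp_gen_iff (by norm_num)).2 ?_
    exact (p.summable_iff (f := fun k => ‖v k‖ ^ (2 : ℝ≥0∞).toReal)).2
      ((memℓp_gen_iff (by norm_num)).1 (lp.memℓp v))⟩
  left_inv v := by ext k; simp
  right_inv v := by ext k; simp
  map_add' v w := by ext k; rfl
  map_smul' c v := by ext k; simp
  norm_map' v := by
    have h2 : 0 < (2 : ℝ≥0∞).toReal := by norm_num
    rw [lp.norm_eq_tsum_rpow h2, lp.norm_eq_tsum_rpow h2]
    congr 1
    exact p.symm.tsum_eq fun k => ‖v k‖ ^ (2 : ℝ≥0∞).toReal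

theorem permUnitary_apply {J : Type*} (p : Equiv.Perm J) (v : lp (fun _ : J => ℂ) 2) (k : J) :
    permUnitary p v k = v (p.symm k) := rfl

/-- Expresses closeness to a basis vector through the norm and one coefficient; the Borel hypothesis
on `W` concerns coefficients only. -/
theorem norm_sub_single_sq {J : Type*} [DecidableEq J] (v : lp (fun _ : J => ℂ) 2) (k : J) :
    ‖v - lp.single 2 k (1 : ℂ)‖ ^ 2 = ‖v‖ ^ 2 - 2 * (v k).re + 1 := by
  rw [@norm_sub_sq ℂ, lp.inner_single_right, lp.norm_single (by norm_num)]
  simp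

instance separableSpace_l2 {J : Type*} [Countable J] : SeparableSpace (lp (fun _ : J => ℂ) 2) := by
  let b : HilbertBasis J ℂ (lp (fun _ : J => ℂ) 2) := .ofRepr (LinearIsometryEquiv.refl ℂ _)
  have h := ((countable_range b).isSeparable.span (R := ℂ)).closure
  rw [← Submodule.topologicalClosure_coe, b.dense_span] at h
  exact isSeparable_univ_iff.1 h

variable {X : Type u} [MeasurableSpace X]
  {R S : DiscreteBorelEquivRel X} {N : ℕ∞} {φ : IndexSet N → X → X} {μ : Measure X}

/-- The field `W (x, i)` is the permutation unitary of `ψ x`, independent of `i`. -/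
theorem isZimmerNormal_of_isCoboundaryOn [SFinite μ] {σ : X → X → Equiv.Perm (IndexSet N)}
    (h : IsCoboundaryOn μ S σ) : IsZimmerNormal μ S σ := by
  obtain ⟨ψ, hψ, hσ⟩ := h
  refine ⟨fun p => permUnitary (ψ p.1), fun v k => ?_, ?_⟩
  · have hinv : Measurable fun x => (ψ x).symm k := measurable_to_countable' fun j => by
      have : (fun x => (ψ x).symm k) ⁻¹' {j} = (fun x => ψ x j) ⁻¹' {k} := by
        ext x
        simp only [mem_preimage, mem_singleton_iff, Equiv.symm_apply_eq]
        exact eq_comm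
      rw [this]
      exact hψ j (measurableSet_singleton k)
    exact (measurable_of_countable fun j => v j).comp (hinv.comp measurable_fst)
  · filter_upwards [Measure.quasiMeasurePreserving_fst.ae hσ] with p hp q hpq v k
    rw [hp _ hpq.1, permUnitary_apply, permUnitary_apply]
    simp

/-- Let `i` be the index of the class of `x` itself. Over `S` the cocycle carries the own index of
`y` to that of `x`, so the triviality of the pullback applies along these points. The label of `k`
is the first term of a dense sequence sent by `W (x, i)` to within `1/2` of the `k`-th basis vector;
distinct basis vectors are `√2 > 1` apart, so labels are distinct. -/
theorem isCoboundaryOn_of_isZimmerNormal [StandardBorelSpace X] [IsFiniteMeasure μ]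
    (hq : R.toGroupoid.QuasiInvariant μ) (hSR : ∀ x y, S.r x y → R.r x y)
    (hφ : IsChoiceFamily μ R S φ) (h : IsZimmerNormal μ S (indexCocycle S φ)) : IsCoboundaryOn μ S (indexCocycle S φ) := by
  classical
  obtain ⟨W, hW, hWσ⟩ := h
  have hWσ' : ∀ᵐ x ∂μ, ∀ i, ∀ q, SkewProductRel S (indexCocycle S φ) (x, i) q →
      ∀ v k, W (x, i) v (indexCocycle S φ x q.1 k) = W q v k := by
    filter_upwards [Measure.ae_ae_of_ae_prod hWσ] with x hx
    exact Measure.ae_count_iff.1 hx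
  obtain ⟨d, hd⟩ := exists_dense_seq (lp (fun _ : IndexSet N => ℂ) 2)
  -- The inequality is the square of a distance below `1/2`, expanded so as to be Borel in `x`.
  let A : IndexSet N → X → Set ℕ := fun k x =>
    {n | ∃ i, S.r (φ i x) x ∧ ‖d n‖ ^ 2 - 2 * (W (x, i) (d n) k).re + 1 < 1 / 4}
  have hA : ∀ {k x n}, n ∈ A k x ↔ ∃ i, S.r (φ i x) x ∧
      ‖W (x, i) (d n) - lp.single 2 k (1 : ℂ)‖ < 1 / 2 := fun {k x n} => by
    refine exists_congr fun i => and_congr_right fun _ => ?_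
    rw [← (W (x, i)).norm_map (d n), ← norm_sub_single_sq,
      show (1 / 4 : ℝ) = (1 / 2) ^ 2 by norm_num]
    exact pow_lt_pow_iff_left₀ (norm_nonneg (W (x, i) (d n) - lp.single 2 k (1 : ℂ)))
      (show (0 : ℝ) ≤ 1 / 2 by norm_num) two_ne_zero
  have hmem : ∀ {x}, IsChoiceAt R S φ x → ∀ k, sInf (A k x) ∈ A k x := fun {x} hx k => by
    obtain ⟨i, hi⟩ := (hx.2 x (R.iseqv.refl x)).exists
    obtain ⟨n, hn⟩ := hd.exists_dist_lt ((W (x, i)).symm (lp.single 2 k (1 : ℂ)))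
      (show (0 : ℝ) < 1 / 2 by norm_num)
    refine Nat.sInf_mem ⟨n, hA.2 ⟨i, hi, ?_⟩⟩
    rw [dist_comm, dist_eq_norm, ← (W (x, i)).norm_map, map_sub,
      LinearIsometryEquiv.apply_symm_apply] at hn
    exact hn
  refine isCoboundaryOn_of_label hq hSR (fun k x => sInf (A k x))
    (fun k => measurable_sInf_nat fun n => ?_) ?_ ?_
  · have : {x | n ∈ A k x} = ⋃ i, {x | S.r (φ i x) x} ∩
        {x | ‖d n‖ ^ 2 - 2 * (W (x, i) (d n) k).re + 1 < 1 / 4} := by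
      ext x; simp [A]
    rw [this]
    refine .iUnion fun i => (S.measurableSet_rel (hφ.measurable i) measurable_id).inter
      (measurableSet_lt ?_ measurable_const)
    exact (measurable_const.sub (measurable_const.mul (Complex.measurable_re.comp
      ((hW (d n) k).comp measurable_prodMk_right)))).add measurable_const
  · filter_upwards [hφ.ae_isChoiceAt] with x hx k l hkl
    by_contra hne
    obtain ⟨i, hi, h1⟩ := hA.1 (hmem hx k)
    obtain ⟨j, hj, h2⟩ := hA.1 (hmem hx l)
    simp only [show sInf (A k x) = sInf (A l x) from hkl, hx.eq hi hj] at h1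
    have h3 := norm_sub_single_sq (lp.single 2 l (1 : ℂ)) k
    rw [lp.single_apply_ne _ _ _ (hne), lp.norm_single (by norm_num)] at h3
    have h4 := norm_sub_le_norm_sub_add_norm_sub (lp.single 2 l (1 : ℂ))
      (W (x, j) (d (sInf (A l x)))) (lp.single (E := fun _ : IndexSet N => ℂ) 2 k (1 : ℂ))
    rw [norm_sub_rev _ (W (x, j) (d (sInf (A l x))))] at h4
    have h6 := pow_lt_pow_left₀ (h4.trans_lt (add_lt_add h2 h1)) (norm_nonneg _) two_ne_zero
    rw [h3] at h6
    norm_num at h6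
  · filter_upwards [ae_forall_rel hq hφ.ae_isChoiceAt, hWσ'] with x hx hxW y hxy k
    have hyR := hSR x y hxy
    have hx0 := hx x (R.iseqv.refl x)
    have hy0 := hx y hyR
    obtain ⟨j, hj⟩ := (hy0.2 y (R.iseqv.refl y)).exists
    have hσ := hx0.rel_indexCocycle hy0 hyR
    have hi : S.r (φ (indexCocycle S φ x y j) x) x :=
      S.iseqv.trans (hσ j) (S.iseqv.trans hj (S.iseqv.symm hxy))
    have hWn := fun n => hxW (indexCocycle S φ x y j) (y, j) ⟨hxy, rfl⟩ (d n) k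
    congr 1
    ext n
    constructor
    · rintro ⟨i, hi', h⟩
      rw [hx0.eq hi' hi, hWn] at h
      exact ⟨j, hj, h⟩
    · rintro ⟨j', hj', h⟩
      rw [hy0.eq hj' hj, ← hWn] at h
      exact ⟨_, hi, h⟩

end Zimmer

/-! ### Algebra in a groupoid. -/

namespace DiscreteBorelGroupoid

variable {G : DiscreteBorelGroupoid.{u}}

theorem mul_congr {g g' h h' : G.Arr} (hg : g = g') (hh : h = h') (e : G.src g = G.rng h)
    (e' : G.src g' = G.rng h') : G.mul g h e = G.mul g' h' e' := by
  subst hg hh; rfl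

theorem one_mul_of_eq {k g : G.Arr} (hk : k ∈ range G.one) (e : G.src k = G.rng g) :
    G.mul k g e = g := by
  obtain ⟨z, rfl⟩ := hk
  have hz : z = G.rng g := (G.src_one z).symm.trans e
  rw [mul_congr (congrArg G.one hz) rfl e (G.src_one _), G.one_mul]

theorem mul_one_of_eq {k g : G.Arr} (hk : k ∈ range G.one) (e : G.src g = G.rng k) :
    G.mul g k e = g := by
  obtain ⟨z, rfl⟩ := hk
  have hz : z = G.src g := ((G.rng_one z).symm.trans e.symm)
  rw [mul_congr rfl (congrArg G.one hz) e (G.rng_one _).symm, G.mul_one]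

theorem mul_mul_inv (g h : G.Arr) (e : G.src g = G.rng h) :
    G.mul (G.mul g h e) (G.inv h) ((G.src_mul g h e).trans (G.rng_inv h).symm) = g := by
  rw [G.mul_assoc g h (G.inv h) e (G.rng_inv h).symm,
    mul_congr rfl (G.mul_inv h) _ (e.trans (G.rng_one _).symm),
    mul_one_of_eq (mem_range_self _)]

theorem mul_right_cancel {g g' h : G.Arr} {e : G.src g = G.rng h} {e' : G.src g' = G.rng h}
    (hgg : G.mul g h e = G.mul g' h e') : g = g' := by
  rw [← mul_mul_inv g h e, ← mul_mul_inv g' h e']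
  exact mul_congr hgg rfl _ _

theorem eq_one_of_mul_eq_right {g h : G.Arr} {e : G.src g = G.rng h} (hgh : G.mul g h e = h) :
    g = G.one (G.rng h) :=
  mul_right_cancel (e' := G.src_one _) (hgh.trans (G.one_mul h).symm)

theorem eq_inv_of_mul_eq_one {g h : G.Arr} {e : G.src g = G.rng h}
    (hgh : G.mul g h e = G.one (G.src h)) : g = G.inv h :=
  mul_right_cancel (e' := G.src_inv h) (hgh.trans (G.inv_mul h).symm)

/-- A total Borel extension allows products to be written before composability is known, as in
`IsFunctorialAt`. -/
theorem exists_measurable_mul (G : DiscreteBorelGroupoid.{u}) :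
    ∃ m : G.Arr × G.Arr → G.Arr, Measurable m ∧
      ∀ g h (e : G.src g = G.rng h), m (g, h) = G.mul g h e := by
  have hm : MeasurableSet {p : G.Arr × G.Arr | G.src p.1 = G.rng p.2} :=
    measurableSet_eq_fun (G.measurable_src.comp measurable_fst)
      (G.measurable_rng.comp measurable_snd)
  obtain ⟨m, hm, h⟩ := (MeasurableEmbedding.subtype_coe hm).exists_measurable_extend
    G.measurable_mul fun p => ⟨p.1⟩
  exact ⟨m, hm, fun g h' e => congrFun h ⟨(g, h'), e⟩⟩

end DiscreteBorelGroupoid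

/-! ### Kernels of homomorphisms, and the coboundary they produce. -/

section Kernels


variable {X : Type u} [MeasurableSpace X] [StandardBorelSpace X]
  {R S : DiscreteBorelEquivRel X} {H : DiscreteBorelGroupoid.{u}}

theorem arr_mul_rel (θ : R.toGroupoid.Hom H) {x y z : X} (hxy : R.r x y) (hyz : R.r y z) :
    ∃ e, θ.arr ⟨(x, z), R.iseqv.trans hxy hyz⟩ =
      H.mul (θ.arr ⟨(x, y), hxy⟩) (θ.arr ⟨(y, z), hyz⟩) e :=
  ⟨_, θ.arr_mul ⟨(x, y), hxy⟩ ⟨(y, z), hyz⟩ rfl⟩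

/-- In the factorization `(x, y) = (x, x') (x', y') (y', y)` the outer factors go to units. -/
theorem arr_eq_of_mem_relKer (θ : R.toGroupoid.Hom H) {x x' y y' : X} (hx : (x, x') ∈ relKer θ)
    (hy : (y', y) ∈ relKer θ) (hxy : R.r x y) (hxy' : R.r x' y') :
    θ.arr ⟨(x, y), hxy⟩ = θ.arr ⟨(x', y'), hxy'⟩ := by
  obtain ⟨hxx, hx⟩ := hx
  obtain ⟨hyy, hy⟩ := hy
  obtain ⟨e, h1⟩ := arr_mul_rel θ hxx (R.iseqv.trans hxy' hyy)
  obtain ⟨e', h2⟩ := arr_mul_rel θ hxy' hyy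
  exact h1.trans ((one_mul_of_eq hx e).trans (h2.trans (mul_one_of_eq hy e')))

theorem mem_relKer_of_arr_eq (θ : R.toGroupoid.Hom H) {x x' y : X} (hx : R.r x y)
    (hx' : R.r x' y) (h : θ.arr ⟨(x, y), hx⟩ = θ.arr ⟨(x', y), hx'⟩) : (x, x') ∈ relKer θ := by
  have hxx := R.iseqv.trans hx (R.iseqv.symm hx')
  obtain ⟨e, h1⟩ := arr_mul_rel θ hxx hx'
  exact ⟨hxx, _, (eq_one_of_mul_eq_right (h1.symm.trans h)).symm⟩

theorem obj_eq_of_mem_relKer (θ : R.toGroupoid.Hom H) {x y : X} (h : (x, y) ∈ relKer θ) :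
    θ.obj x = θ.obj y := by
  obtain ⟨hxy, z, hz⟩ := h
  have h1 := θ.src_arr ⟨(x, y), hxy⟩
  have h2 := θ.rng_arr ⟨(x, y), hxy⟩
  rw [← hz] at h1 h2
  rw [H.src_one] at h1
  rw [H.rng_one] at h2
  exact h2.symm.trans h1

variable {N : ℕ∞} {φ : IndexSet N → X → X} {μ : Measure X} [IsFiniteMeasure μ]

/-- The label of `k` at `x` is that of the arrow `c (φ k x, x)` in its source fibre. Equal arrows
force `S`-equivalent choices, and moving either end within its `S`-class leaves the arrow unchanged.
-/
theorem isCoboundaryOn_of_kerEq (hq : R.toGroupoid.QuasiInvariant μ)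
    (hSR : ∀ x y, S.r x y → R.r x y) (hφ : IsChoiceFamily μ R S φ) (c : R.toGroupoid.Hom H)
    (hc : KerEq μ c S) : IsCoboundaryOn μ S (indexCocycle S φ) := by
  classical
  -- The image measure is used because injectivity is needed over `c.obj x` for almost every `x`.
  obtain ⟨l, hl, hinj⟩ := exists_measurable_fiber_label (μ.map c.obj) H.measurable_src
    H.countable_src
  have hinj' := ae_of_ae_map c.measurable_obj.aemeasurable hinj
  -- The default `x` makes `(f k x, x)` a pair of `R` for every `x`, so `c` can be applied to it.
  let f : IndexSet N → X → X := fun k x => if R.r (φ k x) x then φ k x else x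
  have hf : ∀ k, Measurable (f k) := fun k =>
    Measurable.ite (R.measurableSet_rel (hφ.measurable k) measurable_id) (hφ.measurable k)
      measurable_id
  have hfR : ∀ k x, R.r (f k x) x := fun k x => by
    by_cases h : R.r (φ k x) x
    · simp only [f, if_pos h, h]
    · simp only [f, if_neg h]
      exact R.iseqv.refl x
  have hfφ : ∀ {x}, IsChoiceAt R S φ x → ∀ k, f k x = φ k x := fun hx k =>
    if_pos (R.iseqv.symm (hx.1 k))
  have hm : ∀ k, Measurable fun x => c.arr ⟨(f k x, x), hfR k x⟩ := fun k =>
    c.measurable_arr.comp ((hf k).prodMk measurable_id).subtype_mk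
  refine isCoboundaryOn_of_label hq hSR (fun k x => l (c.arr ⟨(f k x, x), hfR k x⟩))
    (fun k => hl.comp (hm k)) ?_ ?_
  · filter_upwards [hinj', ae_forall_rel hq (hφ.ae_isChoiceAt.and hc)] with x hxl hx i j hij
    obtain ⟨hx0, -⟩ := hx x (R.iseqv.refl x)
    have h1 := hxl (c.src_arr _) (c.src_arr _) hij
    have h2 := ((hx _ (R.iseqv.symm (hfR i x))).2 _).1 (mem_relKer_of_arr_eq c _ _ h1)
    rw [hfφ hx0, hfφ hx0] at h2
    exact hx0.eq h2 (S.iseqv.refl _)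
  · filter_upwards [ae_forall_rel hq (hφ.ae_isChoiceAt.and hc)] with x hx y hxy k
    have hyR := hSR x y hxy
    obtain ⟨hx0, hxc⟩ := hx x (R.iseqv.refl x)
    obtain ⟨hy0, hyc⟩ := hx y hyR
    have hσ := hx0.rel_indexCocycle hy0 hyR k
    rw [← hfφ hx0, ← hfφ hy0] at hσ
    refine congrArg l (arr_eq_of_mem_relKer c ?_ ((hyc _).2 (S.iseqv.symm hxy)) _ _)
    exact ((hx _ (R.iseqv.symm (hfR _ x))).2 _).2 hσ

end Kernels

/-! ### The factor generated by the `S`-invariant sets. -/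

section InvariantFactor

open ProbabilityTheory

/-- Integration against a probability measure on a standard Borel space is a Borel function of
countably many values of the measure. -/
theorem exists_integral_eq_measurable {α X : Type*} [MeasurableSpace X] [StandardBorelSpace X]
    (κ : α → Measure X) [hκ : ∀ a, IsProbabilityMeasure (κ a)] {F : X → ℝ} (hF : Measurable F) :
    ∃ g : (ℚ → ℝ≥0∞) → ℝ, Measurable g ∧
      ∀ a, ∫ y, F y ∂(κ a) = g fun r => κ a (embeddingReal X ⁻¹' Iic (r : ℝ)) := by
  let e : X → ℝ := embeddingReal X
  have he : MeasurableEmbedding e := measurableEmbedding_embeddingReal X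
  let q : α → ℚ → ℝ≥0∞ := fun a r => κ a (e ⁻¹' Iic (r : ℝ))
  -- For the σ-algebra pulled back along the distribution functions `q`, the map `κ` is a kernel;
  -- integrals against it are then measurable for that σ-algebra, hence Borel functions of `q`.
  let : MeasurableSpace α := MeasurableSpace.comap q inferInstance
  have hκ : Measurable κ := by
    refine .measure_of_isPiSystem_of_isProbabilityMeasure
      (S := {s | ∃ t ∈ ⋃ a : ℚ, {Iic (a : ℝ)}, e ⁻¹' t = s}) ?_ ?_ ?_
    · rw [← he.comap_eq, BorelSpace.measurable_eq (α := ℝ), Real.borel_eq_generateFrom_Iic_rat,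
        MeasurableSpace.comap_generateFrom]
      rfl
    · exact Real.isPiSystem_Iic_rat.comap e
    · rintro _ ⟨t, ht, rfl⟩
      obtain ⟨r, rfl⟩ := mem_iUnion.1 ht
      exact (measurable_pi_apply r).comp (comap_measurable q)
  obtain ⟨g, hg, hgq⟩ := (hF.stronglyMeasurable.integral_kernel
    (κ := Kernel.mk κ hκ)).measurable.exists_eq_measurable_comp
  exact ⟨g, hg, fun a => congrFun hgq a⟩

/-- Every real function that is measurable with respect to `m` is a Borel function of `p`, almost
everywhere. -/
def GeneratesMod {X Y : Type*} (m : MeasurableSpace X) [MeasurableSpace X] [MeasurableSpace Y]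
    (μ : Measure X) (p : X → Y) : Prop :=
  ∀ f : X → ℝ, Measurable[m] f → ∃ g : Y → ℝ, Measurable g ∧ ∀ᵐ x ∂μ, f x = g (p x)

theorem GeneratesMod.exists_factor {X Y : Type*} {m : MeasurableSpace X} [MeasurableSpace X]
    [MeasurableSpace Y] {μ : Measure X} {p : X → Y} (h : GeneratesMod m μ p) {Z : Type*}
    [MeasurableSpace Z] [StandardBorelSpace Z] [Nonempty Z] {f : X → Z} (hf : Measurable[m] f) :
    ∃ g : Y → Z, Measurable g ∧ ∀ᵐ x ∂μ, f x = g (p x) := by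
  have he := measurableEmbedding_embeddingReal Z
  obtain ⟨g, hg, hgp⟩ := h _ (he.measurable.comp hf)
  refine ⟨fun y => he.invFun (g y), he.measurable_invFun.comp hg, ?_⟩
  filter_upwards [hgp] with x hx
  rw [← hx]
  exact (he.leftInverse_invFun (f x)).symm

/-- A sub-σ-algebra of a standard probability space is generated, up to null sets, by a real
function. -/
theorem exists_generatesMod {X : Type*} {m : MeasurableSpace X} [mX : MeasurableSpace X]
    [StandardBorelSpace X] (hm : m ≤ mX) (μ : Measure X) [IsFiniteMeasure μ] :
    ∃ p : X → ℝ, Measurable[m] p ∧ GeneratesMod m μ p := by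
  have he : MeasurableEmbedding (embeddingReal X) := measurableEmbedding_embeddingReal X
  -- The distribution function of the conditional law given `m`. A bounded `m`-measurable function
  -- is its own conditional expectation, hence almost everywhere a Borel function of `q`.
  let q : X → ℚ → ℝ≥0∞ := fun x r => condExpKernel μ m x (embeddingReal X ⁻¹' Iic (r : ℝ))
  have hq : Measurable[m] q :=
    @measurable_pi_lambda X ℚ _ m _ _ fun r =>
      measurable_condExpKernel (he.measurable measurableSet_Iic)
  have hi := measurableEmbedding_embeddingReal (ℚ → ℝ≥0∞)
  refine ⟨fun x => embeddingReal _ (q x), hi.measurable.comp hq, fun f hf => ?_⟩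
  -- The sigmoid makes `f` bounded, hence integrable, and can be undone by a Borel map.
  have hez : MeasurableEmbedding fun t : ℝ => (unitInterval.sigmoid t : ℝ) :=
    (MeasurableEmbedding.subtype_coe (measurableSet_Icc (a := (0 : ℝ)) (b := 1))).comp
      measurableEmbedding_sigmoid
  let F : X → ℝ := fun x => unitInterval.sigmoid (f x)
  have hF : Measurable[m] F := hez.measurable.comp hf
  have hFX : Measurable F := hF.mono hm le_rfl
  have hFint : Integrable F μ := by
    refine .of_bound hFX.aestronglyMeasurable 1 (.of_forall fun x => ?_)
    rw [Real.norm_of_nonneg (unitInterval.nonneg _)]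
    exact unitInterval.le_one _
  have h1 := condExp_ae_eq_integral_condExpKernel hm hFint
  rw [condExp_of_stronglyMeasurable hm hF.stronglyMeasurable hFint] at h1
  obtain ⟨g, hg, hgq⟩ := exists_integral_eq_measurable (fun x => condExpKernel μ m x)
    (hκ := (inferInstance : @IsMarkovKernel X X m mX (condExpKernel μ m)).isProbabilityMeasure) hFX
  refine ⟨fun t => hez.invFun (g (hi.invFun t)),
    hez.measurable_invFun.comp (hg.comp hi.measurable_invFun), ?_⟩
  filter_upwards [h1] with x hx
  rw [hi.leftInverse_invFun, ← hgq x, ← hx]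
  exact (hez.leftInverse_invFun (f x)).symm

/-- The σ-algebra of Borel unions of classes. -/
abbrev DiscreteBorelEquivRel.invariants {X : Type u} [mX : MeasurableSpace X]
    (S : DiscreteBorelEquivRel X) : MeasurableSpace X where
  MeasurableSet' A := MeasurableSet[mX] A ∧ ∀ x y, S.r x y → (x ∈ A ↔ y ∈ A)
  measurableSet_empty := ⟨.empty, by simp⟩
  measurableSet_compl A h := ⟨h.1.compl, fun x y hxy => not_congr (h.2 x y hxy)⟩
  measurableSet_iUnion A h := ⟨.iUnion fun i => (h i).1, fun x y hxy => by
    simp only [mem_iUnion]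
    exact exists_congr fun i => (h i).2 x y hxy⟩

variable {X : Type u} [mX : MeasurableSpace X] {S : DiscreteBorelEquivRel X}

theorem DiscreteBorelEquivRel.invariants_le : S.invariants ≤ mX := fun _ h => h.1

theorem measurable_invariants {Z : Type*} [MeasurableSpace Z] {f : X → Z} (hf : Measurable f)
    (hinv : ∀ x y, S.r x y → f x = f y) : Measurable[S.invariants] f := fun A hA =>
  ⟨hf hA, fun x y hxy => by rw [mem_preimage, mem_preimage, hinv x y hxy]⟩

theorem eq_of_measurable_invariants {Z : Type*} [MeasurableSpace Z] [MeasurableSingletonClass Z]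
    {f : X → Z} (hf : Measurable[S.invariants] f) {x y : X} (hxy : S.r x y) : f x = f y :=
  (((hf (measurableSet_singleton (f y))).2 x y hxy).2 rfl)

end InvariantFactor

/-! ### Groupoids with arrow space `Y × J`. -/

section ArrowLaw

/-- The conditions on partial-action data `(act, mul, unit, inv)` at a point `y` under which the
pairs `(y, j)` are the arrows `y → act j y` of a groupoid. -/
structure ArrowLawAt {Y J : Type*} (act : J → Y → Y) (mul : J → J → Y → J) (unit : Y → J)
    (inv : J → Y → J) (y : Y) : Prop where
  act_mul : ∀ i j, act (mul i j y) y = act i (act j y)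
  mul_assoc : ∀ i j k, mul (mul i j (act k y)) k y = mul i (mul j k y) y
  act_unit : act (unit y) y = y
  unit_mul : ∀ j, mul (unit (act j y)) j y = j
  mul_unit : ∀ j, mul j (unit y) y = j
  act_inv : ∀ j, act (inv j y) (act j y) = y
  inv_mul : ∀ j, mul (inv j y) j y = unit y
  mul_inv : ∀ j, mul j (inv j y) (act j y) = unit (act j y)

/-- A groupoid structure on `Y × J`, the arrow `(y, j)` going from `y` to `act j y`. -/
structure ArrowLaw (Y J : Type*) [MeasurableSpace Y] [MeasurableSpace J] where
  act : J → Y → Y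
  mul : J → J → Y → J
  unit : Y → J
  inv : J → Y → J
  measurable_act : ∀ j, Measurable (act j)
  measurable_mul : ∀ i j, Measurable (mul i j)
  measurable_unit : Measurable unit
  measurable_inv : ∀ j, Measurable (inv j)
  law : ∀ y, ArrowLawAt act mul unit inv y

theorem Measurable.apply_index {Y J Z : Type*} [MeasurableSpace Y] [MeasurableSpace J]
    [Countable J] [MeasurableSingletonClass J] [MeasurableSpace Z] {f : J → Y → Z} {u : Y → J}
    {v : Y → Y} (hf : ∀ j, Measurable (f j)) (hu : Measurable u) (hv : Measurable v) :
    Measurable fun y => f (u y) (v y) :=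
  (measurable_from_prod_countable_right (f := fun q : J × Y => f q.1 q.2) hf).comp (hu.prodMk hv)

variable {Y : Type u} [MeasurableSpace Y] {J : Type} [MeasurableSpace J] [Countable J]
  [MeasurableSingletonClass J]

/-- The groupoid with arrow space `Y × J`. -/
abbrev ArrowLaw.toGroupoid [StandardBorelSpace Y] (L : ArrowLaw Y J) :
    DiscreteBorelGroupoid.{u} where
  Obj := Y
  Arr := Y × J
  src g := g.1
  rng g := L.act g.2 g.1
  one y := (y, L.unit y)
  inv g := (L.act g.2 g.1, L.inv g.2 g.1)
  mul g h _ := (h.1, L.mul g.2 h.2 h.1)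
  src_one _ := rfl
  rng_one y := (L.law y).act_unit
  src_inv _ := rfl
  rng_inv g := (L.law g.1).act_inv g.2
  src_mul _ _ _ := rfl
  rng_mul g h e := ((L.law h.1).act_mul g.2 h.2).trans (congrArg (L.act g.2) e.symm)
  mul_assoc g h k e f := Prod.ext rfl <| by
    dsimp only
    rw [f]
    exact (L.law k.1).mul_assoc g.2 h.2 k.2
  one_mul g := Prod.ext rfl ((L.law g.1).unit_mul g.2)
  mul_one g := Prod.ext rfl ((L.law g.1).mul_unit g.2)
  inv_mul g := Prod.ext rfl ((L.law g.1).inv_mul g.2)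
  mul_inv g := Prod.ext rfl ((L.law g.1).mul_inv g.2)
  measurable_src := measurable_fst
  measurable_rng := measurable_from_prod_countable_left L.measurable_act
  measurable_one := measurable_id.prodMk L.measurable_unit
  measurable_inv := (measurable_from_prod_countable_left L.measurable_act).prodMk
    (measurable_from_prod_countable_left L.measurable_inv)
  measurable_mul := by
    refine (measurable_subtype_coe.snd.fst).prodMk ?_
    exact (measurable_from_prod_countable_right (f := fun q : (J × J) × Y => L.mul q.1.1 q.1.2 q.2)
      fun q => L.measurable_mul q.1 q.2).comp ((measurable_subtype_coe.fst.snd.prodMk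
        measurable_subtype_coe.snd.snd).prodMk measurable_subtype_coe.snd.fst)
  countable_src y := (countable_range fun j : J => (y, j)).mono fun g (hg : g.1 = y) =>
    mem_range.2 ⟨g.2, Prod.ext hg.symm rfl⟩

/-- Since `J` is countable, the laws are countably many Borel equations. Data satisfying them almost
everywhere can thus be restricted to a Borel set of units. -/
theorem measurableSet_arrowLawAt [MeasurableEq Y] {act : J → Y → Y} {mul : J → J → Y → J}
    {unit : Y → J} {inv : J → Y → J} (h1 : ∀ j, Measurable (act j))
    (h2 : ∀ i j, Measurable (mul i j)) (h3 : Measurable unit) (h4 : ∀ j, Measurable (inv j)) :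
    MeasurableSet {y | ArrowLawAt act mul unit inv y} := by
  have : {y | ArrowLawAt act mul unit inv y} =
      (⋂ i, ⋂ j, {y | act (mul i j y) y = act i (act j y)}) ∩
      (⋂ i, ⋂ j, ⋂ k, {y | mul (mul i j (act k y)) k y = mul i (mul j k y) y}) ∩
      {y | act (unit y) y = y} ∩ (⋂ j, {y | mul (unit (act j y)) j y = j}) ∩
      (⋂ j, {y | mul j (unit y) y = j}) ∩ (⋂ j, {y | act (inv j y) (act j y) = y}) ∩
      (⋂ j, {y | mul (inv j y) j y = unit y}) ∩
      ⋂ j, {y | mul j (inv j y) (act j y) = unit (act j y)} := by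
    ext y
    simp only [mem_inter_iff, mem_iInter, mem_ofPred_eq]
    exact ⟨fun ⟨a, b, c, d, e, f, g, h⟩ => ⟨⟨⟨⟨⟨⟨⟨a, b⟩, c⟩, d⟩, e⟩, f⟩, g⟩, h⟩,
      fun ⟨⟨⟨⟨⟨⟨⟨a, b⟩, c⟩, d⟩, e⟩, f⟩, g⟩, h⟩ => ⟨a, b, c, d, e, f, g, h⟩⟩
  rw [this]
  have hid : Measurable fun y : Y => y := measurable_id
  refine (((((((MeasurableSet.iInter fun i => .iInter fun j => ?_).inter
    (.iInter fun i => .iInter fun j => .iInter fun k => ?_)).inter ?_).inter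
    (.iInter fun j => ?_)).inter (.iInter fun j => ?_)).inter (.iInter fun j => ?_)).inter
    (.iInter fun j => ?_)).inter (.iInter fun j => ?_) <;> refine measurableSet_eq_fun ?_ ?_
  · exact .apply_index h1 (h2 i j) hid
  · exact (h1 i).comp (h1 j)
  · exact .apply_index (f := fun l => mul l k) (fun l => h2 l k) ((h2 i j).comp (h1 k)) hid
  · exact .apply_index (f := fun l => mul i l) (fun l => h2 i l) (h2 j k) hid
  · exact .apply_index h1 h3 hid
  · exact hid
  · exact .apply_index (f := fun l => mul l j) (fun l => h2 l j) (h3.comp (h1 j)) hid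
  · exact measurable_const
  · exact .apply_index (f := fun l => mul j l) (fun l => h2 j l) h3 hid
  · exact measurable_const
  · exact .apply_index h1 (h4 j) (h1 j)
  · exact hid
  · exact .apply_index (f := fun l => mul l j) (fun l => h2 l j) (h4 j) hid
  · exact h3
  · exact .apply_index (f := fun l => mul j l) (fun l => h2 j l) (h4 j) (h1 j)
  · exact h3.comp (h1 j)

end ArrowLaw

/-! ### Construction of the quotient groupoid. -/

section QuotientMap

variable {X : Type u} [MeasurableSpace X] {R S : DiscreteBorelEquivRel X} {N : ℕ∞}
  {φ : IndexSet N → X → X} {μ : Measure X}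

-- Uniqueness of the index turns its level sets into Borel conditions.
open Classical in
theorem exists_measurable_index (hφ : ∀ j, Measurable (φ j)) {Ω : Type*} [MeasurableSpace Ω]
    {b f : Ω → X} (hb : Measurable b) (hf : Measurable f) {B : Set Ω} (hB : MeasurableSet B)
    (h : ∀ w ∈ B, IsChoiceAt R S φ (b w) ∧ R.r (b w) (f w)) (j₀ : IndexSet N) :
    ∃ u : Ω → IndexSet N, Measurable u ∧ (∀ w ∈ B, S.r (φ (u w) (b w)) (f w)) ∧
      ∀ w ∉ B, u w = j₀ := by
  have : Nonempty (IndexSet N) := ⟨j₀⟩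
  choose! v hv using fun w hw => ((h w hw).1.2 _ (h w hw).2).exists
  let u : Ω → IndexSet N := fun w => if w ∈ B then v w else j₀
  have hu : ∀ w ∈ B, S.r (φ (u w) (b w)) (f w) := fun w hw => by
    simp only [u, if_pos hw]
    exact hv w hw
  have hu' : ∀ w ∉ B, u w = j₀ := fun w hw => if_neg hw
  refine ⟨u, measurable_to_countable' fun j => ?_, hu, hu'⟩
  have : u ⁻¹' {j} = B.ite {w | S.r (φ j (b w)) (f w)} {_w | j₀ = j} := by
    ext w
    by_cases hw : w ∈ B
    · simp only [mem_preimage, mem_singleton_iff, Set.ite, mem_union, mem_inter_iff, mem_ofPred_eq,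
        hw, and_true, Set.mem_sdiff, not_true, and_false, or_false]
      exact ⟨fun e => e ▸ hu w hw, fun e => (h w hw).1.eq (hu w hw) e⟩
    · simp [hu' w hw, hw, Set.ite]
  rw [this]
  exact hB.ite (S.measurableSet_rel ((hφ j).comp hb) hf) (.const _)

/-- A Borel map `P` onto (most of) the unit space of a groupoid `L`, modelling the quotient of `X`
by `S`, in which the arrow `(P x, j)` represents the pair `(φ j x, x)`. -/
structure IsQuotientMap (μ : Measure X) (R S : DiscreteBorelEquivRel X) (φ : IndexSet N → X → X)
    {Y : Type u} [MeasurableSpace Y] (L : ArrowLaw Y (IndexSet N)) (A : Set X) (P : X → Y) :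
    Prop where
  measurable_choice : ∀ j, Measurable (φ j)
  measurable : Measurable P
  conull : IsConullInvariant μ R A
  choice : ∀ x ∈ A, IsChoiceAt R S φ x
  endo : ∀ x ∈ A, ∀ j y, S.r x y → S.r (φ j x) (φ j y)
  invariant : ∀ x ∈ A, ∀ y, S.r x y → P x = P y
  const : ∀ x ∉ A, ∀ y ∉ A, P x = P y
  act : ∀ x ∈ A, ∀ j, L.act j (P x) = P (φ j x)
  mul : ∀ x ∈ A, ∀ i j, S.r (φ (L.mul i j (P x)) x) (φ i (φ j x))
  unit : ∀ x ∈ A, S.r (φ (L.unit (P x)) x) x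
  generates : GeneratesMod S.invariants μ P

variable [StandardBorelSpace X] [IsProbabilityMeasure μ]

/-- Because the `φ j` are endomorphisms, all indices that describe composition, units and inverses
are `S`-invariant and descend along a real generator `p`. The groupoid laws hold at `p x` for almost
every `x`, since an index is determined by the `S`-class it selects. -/
theorem exists_isQuotientMap (hq : R.toGroupoid.QuasiInvariant μ)
    (hSR : ∀ x y, S.r x y → R.r x y) (hφ : IsChoiceFamily μ R S φ)
    (he : ∀ j, IsEndomorphism μ S (φ j)) :
    ∃ (Y : Type u) (_ : MeasurableSpace Y) (_ : StandardBorelSpace Y)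
      (L : ArrowLaw Y (IndexSet N)) (A : Set X) (P : X → Y), IsQuotientMap μ R S φ L A P := by
  classical
  obtain ⟨A, hA, hA'⟩ := exists_isConullInvariant hq (hφ.ae_isChoiceAt.and (ae_all_iff.2 he))
  have hch : ∀ x ∈ A, IsChoiceAt R S φ x := fun x hx => (hA' x hx).1
  have hendo : ∀ x ∈ A, ∀ j y, S.r x y → S.r (φ j x) (φ j y) := fun x hx => (hA' x hx).2
  have hφA : ∀ x ∈ A, ∀ j, φ j x ∈ A := fun x hx j => (hA.mem_iff ((hch x hx).1 j)).1 hx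
  have hSA : ∀ x y, S.r x y → (x ∈ A ↔ y ∈ A) := fun x y h => hA.mem_iff (hSR x y h)
  obtain ⟨x₀, hx₀⟩ := hA.ae_mem.exists
  obtain ⟨j₀, -⟩ := ((hch x₀ hx₀).2 x₀ (R.iseqv.refl x₀)).exists
  have : Nonempty (IndexSet N) := ⟨j₀⟩
  obtain ⟨p, hp, hgen⟩ := exists_generatesMod S.invariants_le μ
  have hpinv : ∀ x y, S.r x y → p x = p y := fun x y => eq_of_measurable_invariants hp
  have hpm : Measurable p := hp.mono S.invariants_le le_rfl
  -- descent of `S`-invariant functions along `p`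
  have hdesc : ∀ (b f : X → X), Measurable b → Measurable f →
      (∀ x ∈ A, b x ∈ A ∧ R.r (b x) (f x)) →
      (∀ x ∈ A, ∀ y, S.r x y → S.r (b x) (b y) ∧ S.r (f x) (f y)) →
      ∃ u : ℝ → IndexSet N, Measurable u ∧ ∀ᵐ x ∂μ, x ∈ A → S.r (φ (u (p x)) (b x)) (f x) := by
    intro b f hb hf h1 h2
    obtain ⟨v, hv, hvA, hvA'⟩ := exists_measurable_index (R := R) (S := S) hφ.measurable hb hf
      hA.measurableSet (fun x hx => ⟨hch _ (h1 x hx).1, (h1 x hx).2⟩) j₀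
    have hvinv : ∀ x y, S.r x y → v x = v y := by
      intro x y hxy
      by_cases hx : x ∈ A
      · have hy := (hSA x y hxy).1 hx
        have h3 := h2 x hx y hxy
        refine (hch _ (h1 x hx).1).eq (hvA x hx) ?_
        exact S.iseqv.trans (hendo _ (h1 x hx).1 _ _ h3.1)
          (S.iseqv.trans (hvA y hy) (S.iseqv.symm h3.2))
      · rw [hvA' x hx, hvA' y (fun hy => hx ((hSA x y hxy).2 hy))]
    obtain ⟨u, hu, hup⟩ := hgen.exists_factor (measurable_invariants hv hvinv)
    exact ⟨u, hu, hup.mono fun x hx hxA => hx ▸ hvA x hxA⟩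
  have hrel : ∀ x ∈ A, ∀ i j, R.r x (φ i (φ j x)) := fun x hx i j =>
    R.iseqv.trans ((hch x hx).1 j) ((hch _ (hφA x hx j)).1 i)
  have hmul := fun i j => hdesc id (fun x => φ i (φ j x)) measurable_id
    ((hφ.measurable i).comp (hφ.measurable j)) (fun x hx => ⟨hx, hrel x hx i j⟩)
    fun x hx y hxy => ⟨hxy, hendo _ (hφA x hx j) i _ (hendo x hx j y hxy)⟩
  choose mul hmulm hmul using hmul
  obtain ⟨unit, hunitm, hunit⟩ := hdesc id id measurable_id measurable_id
    (fun x hx => ⟨hx, R.iseqv.refl x⟩) fun x hx y hxy => ⟨hxy, hxy⟩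
  have hinv := fun j => hdesc (φ j) id (hφ.measurable j) measurable_id
    (fun x hx => ⟨hφA x hx j, R.iseqv.symm ((hch x hx).1 j)⟩)
    fun x hx y hxy => ⟨hendo x hx j y hxy, hxy⟩
  choose inv hinvm hinv using hinv
  have hact : ∀ j, ∃ g : ℝ → ℝ, Measurable g ∧ ∀ᵐ x ∂μ, x ∈ A → g (p x) = p (φ j x) := by
    intro j
    have hm : Measurable fun x => if x ∈ A then p (φ j x) else 0 :=
      Measurable.ite hA.measurableSet (hpm.comp (hφ.measurable j)) measurable_const
    obtain ⟨g, hg, hgp⟩ := hgen _ (measurable_invariants hm fun x y hxy => by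
      by_cases hx : x ∈ A
      · rw [if_pos hx, if_pos ((hSA x y hxy).1 hx), hpinv _ _ (hendo x hx j y hxy)]
      · rw [if_neg hx, if_neg fun hy => hx ((hSA x y hxy).2 hy)])
    refine ⟨g, hg, hgp.mono fun x hx hxA => ?_⟩
    rw [← hx, if_pos hxA]
  choose act hactm hact using hact
  obtain ⟨B, hB, hB'⟩ := exists_isConullInvariant hq (hA.ae_mem.and ((ae_all_iff.2 hact).and
    ((ae_all_iff.2 fun i => ae_all_iff.2 (hmul i)).and (hunit.and (ae_all_iff.2 hinv)))))
  have hBA : ∀ x ∈ B, x ∈ A := fun x hx => (hB' x hx).1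
  have hactB : ∀ x ∈ B, ∀ j, act j (p x) = p (φ j x) := fun x hx j =>
    (hB' x hx).2.1 j (hBA x hx)
  have hmulB : ∀ x ∈ B, ∀ i j, S.r (φ (mul i j (p x)) x) (φ i (φ j x)) := fun x hx i j =>
    (hB' x hx).2.2.1 i j (hBA x hx)
  have hunitB : ∀ x ∈ B, S.r (φ (unit (p x)) x) x := fun x hx => (hB' x hx).2.2.2.1 (hBA x hx)
  have hinvB : ∀ x ∈ B, ∀ j, S.r (φ (inv j (p x)) (φ j x)) x := fun x hx j =>
    (hB' x hx).2.2.2.2 j (hBA x hx)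
  have hφB : ∀ x ∈ B, ∀ j, φ j x ∈ B := fun x hx j =>
    (hB.mem_iff ((hch x (hBA x hx)).1 j)).1 hx
  have hlawB : ∀ x ∈ B, ArrowLawAt act mul unit inv (p x) := fun x hx => by
    have heq : ∀ {i j : IndexSet N} {z : X}, S.r (φ i x) z → S.r (φ j x) z → i = j :=
      (hch x (hBA x hx)).eq
    have he' : ∀ {y z}, y ∈ B → ∀ j, S.r y z → S.r (φ j y) (φ j z) := fun hy j h =>
      hendo _ (hBA _ hy) j _ h
    constructor
    · intro i j
      rw [hactB x hx, hactB x hx, hactB _ (hφB x hx j)]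
      exact hpinv _ _ (hmulB x hx i j)
    · intro i j k
      refine heq (hmulB x hx _ k) ?_
      rw [hactB x hx]
      refine S.iseqv.trans (hmulB x hx i _) (S.iseqv.trans (he' (hφB x hx _) i (hmulB x hx j k)) ?_)
      exact S.iseqv.symm (hmulB _ (hφB x hx k) i j)
    · rw [hactB x hx]
      exact hpinv _ _ (hunitB x hx)
    · intro j
      refine heq (hmulB x hx _ j) ?_
      rw [hactB x hx]
      exact S.iseqv.symm (hunitB _ (hφB x hx j))
    · intro j
      exact heq (hmulB x hx j _) (he' hx j (S.iseqv.symm (hunitB x hx)))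
    · intro j
      rw [hactB x hx, hactB _ (hφB x hx j)]
      exact hpinv _ _ (hinvB x hx j)
    · intro j
      exact heq (S.iseqv.trans (hmulB x hx _ j) (hinvB x hx j)) (hunitB x hx)
    · intro j
      rw [hactB x hx]
      refine (hch _ (hBA _ (hφB x hx j))).eq (S.iseqv.trans (hmulB _ (hφB x hx j) j _)
        (he' (hφB _ (hφB x hx j) _) j (hinvB x hx j))) (hunitB _ (hφB x hx j))
  let V : Set ℝ := {y | ArrowLawAt act mul unit inv y}
  have hV : MeasurableSet V := measurableSet_arrowLawAt hactm hmulm hunitm hinvm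
  -- The laws at `y` need not hold at `act j y`. Requiring them on the whole orbit gives a set
  -- stable under the action, because `act i (act j y) = act (mul i j y) y`.
  let V' : Set (ULift.{u} ℝ) := {y | y.down ∈ V ∧ ∀ j, act j y.down ∈ V}
  have hV' : MeasurableSet V' := by
    have : V' = ULift.down ⁻¹' (V ∩ ⋂ j, act j ⁻¹' V) := by
      ext y; simp [V']
    rw [this]
    exact measurable_down (hV.inter (.iInter fun j => hactm j hV))
  have hpV : ∀ x ∈ B, (ULift.up (p x) : ULift.{u} ℝ) ∈ V' := fun x hx =>
    ⟨hlawB x hx, fun j => by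
      show act j (p x) ∈ V
      rw [hactB x hx]
      exact hlawB _ (hφB x hx j)⟩
  have : PolishSpace (ULift.{u} ℝ) := Homeomorph.ulift.isClosedEmbedding.polishSpace
  have hdown : Measurable fun y : V' => y.1.down := measurable_down.comp measurable_subtype_coe
  let act' : IndexSet N → V' → V' := fun j y => ⟨⟨act j y.1.down⟩, y.2.2 j, fun i => by
    show act i (act j y.1.down) ∈ V
    rw [← y.2.1.act_mul]
    exact y.2.2 _⟩
  let L : ArrowLaw V' (IndexSet N) :=
    { act := act'
      mul := fun i j y => mul i j y.1.down
      unit := fun y => unit y.1.down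
      inv := fun j y => inv j y.1.down
      measurable_act := fun j =>
        (measurable_up.comp ((hactm j).comp hdown)).subtype_mk
      measurable_mul := fun i j => (hmulm i j).comp hdown
      measurable_unit := hunitm.comp hdown
      measurable_inv := fun j => (hinvm j).comp hdown
      law := fun y =>
        ⟨fun i j => Subtype.ext (congrArg ULift.up (y.2.1.act_mul i j)), y.2.1.mul_assoc,
          Subtype.ext (congrArg ULift.up y.2.1.act_unit), y.2.1.unit_mul, y.2.1.mul_unit,
          fun j => Subtype.ext (congrArg ULift.up (y.2.1.act_inv j)), y.2.1.inv_mul,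
          y.2.1.mul_inv⟩ }
  obtain ⟨x₁, hx₁⟩ := hB.ae_mem.exists
  let r : ULift.{u} ℝ → V' := fun y => if h : y ∈ V' then ⟨y, h⟩ else ⟨_, hpV x₁ hx₁⟩
  have hr : Measurable r := Measurable.dite (f := fun y : V' => y)
    (g := fun _ => ⟨_, hpV x₁ hx₁⟩) measurable_id measurable_const hV'
  -- The single value off `B` lets the homomorphism send all pairs off `B` to one unit.
  let P : X → V' := fun x => if x ∈ B then r ⟨p x⟩ else ⟨_, hpV x₁ hx₁⟩
  have hP : ∀ x (hx : x ∈ B), P x = ⟨⟨p x⟩, hpV x hx⟩ := fun x hx => by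
    simp only [P, if_pos hx, r, dif_pos (hpV x hx)]
  refine ⟨V', inferInstance, hV'.standardBorel, L, B, P, hφ.measurable, ?_, hB,
    fun x hx => hch x (hBA x hx), fun x hx => hendo x (hBA x hx), fun x hx y hxy => ?_,
    fun x hx y hy => ?_, fun x hx j => ?_, fun x hx i j => ?_, fun x hx => ?_, fun f hf => ?_⟩
  · exact Measurable.ite hB.measurableSet (hr.comp (measurable_up.comp hpm)) measurable_const
  · rw [hP x hx, hP y ((hB.mem_iff (hSR x y hxy)).1 hx)]
    exact Subtype.ext (congrArg ULift.up (hpinv x y hxy))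
  · simp only [P, if_neg hx, if_neg hy]
  · rw [hP x hx, hP _ (hφB x hx j)]
    exact Subtype.ext (congrArg ULift.up (hactB x hx j))
  · rw [hP x hx]
    exact hmulB x hx i j
  · rw [hP x hx]
    exact hunitB x hx
  · obtain ⟨g, hg, hgp⟩ := hgen f hf
    refine ⟨fun y => g y.1.down, hg.comp hdown, ?_⟩
    filter_upwards [hgp, hB.ae_mem] with x hx hxB
    rw [hP x hxB, hx]

end QuotientMap

theorem DiscreteBorelGroupoid.inv_inv {G : DiscreteBorelGroupoid.{u}} (g : G.Arr) :
    G.inv (G.inv g) = g :=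
  (eq_inv_of_mul_eq_one ((G.mul_inv g).trans (congrArg G.one (G.src_inv g).symm))).symm

/-! ### The homomorphism from `R` to its quotient groupoid. -/

section QuotientHom

variable {X : Type u} [MeasurableSpace X] [StandardBorelSpace X] {R S : DiscreteBorelEquivRel X}
  {N : ℕ∞} {φ : IndexSet N → X → X} {μ : Measure X} {Y : Type u} [MeasurableSpace Y]
  [StandardBorelSpace Y] {L : ArrowLaw Y (IndexSet N)} {A : Set X} {P : X → Y}

/-- The pair `(x, y)` goes to `(P y, k)` with `φ k y` in the `S`-class of `x`; off `A` it goes to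
the unit at the constant value `c`. Multiplicativity on `A` uses that the `φ k` are endomorphisms.
-/
theorem IsQuotientMap.exists_hom (h : IsQuotientMap μ R S φ L A P) [Nonempty X] :
    ∃ θ : R.toGroupoid.Hom L.toGroupoid, θ.obj = P ∧
      ∀ x y (hxy : R.r x y), y ∈ A → S.r (φ (θ.arr ⟨(x, y), hxy⟩).2 y) x := by
  obtain ⟨c, hc⟩ : ∃ c, ∀ x ∉ A, P x = c := by
    by_cases hA : ∃ x, x ∉ A
    · obtain ⟨x, hx⟩ := hA
      exact ⟨P x, fun y hy => h.const y hy x hx⟩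
    · exact ⟨P (Classical.arbitrary X), fun x hx => absurd ⟨x, hx⟩ hA⟩
  let Z := {p : X × X // R.r p.1 p.2}
  have hsrc : Measurable fun p : Z => p.1.2 := measurable_subtype_coe.snd
  have hrng : Measurable fun p : Z => p.1.1 := measurable_subtype_coe.fst
  obtain ⟨k, hk, hkA, hkc⟩ := exists_measurable_index (R := R) (S := S) h.measurable_choice
    hsrc hrng (hsrc h.conull.measurableSet)
    (fun p hp => ⟨h.choice _ hp, R.iseqv.symm p.2⟩) (L.unit c)
  have hmem : ∀ {x y}, R.r x y → x ∉ A → y ∉ A := fun hxy hx hy => hx ((h.conull.mem_iff hxy).2 hy)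
  refine ⟨⟨P, fun g => (P g.1.2, k g), h.measurable, (h.measurable.comp hsrc).prodMk hk,
    fun _ => rfl, fun g => ?_, fun g g' e => ?_⟩, rfl, fun x y hxy hy => hkA ⟨(x, y), hxy⟩ hy⟩
  · obtain ⟨⟨x, y⟩, hxy⟩ := g
    by_cases hy : y ∈ A
    · refine (h.act y hy _).trans ?_
      exact h.invariant _ ((h.conull.mem_iff ((h.choice y hy).1 _)).1 hy) _ (hkA ⟨(x, y), hxy⟩ hy)
    · show L.act (k ⟨(x, y), hxy⟩) (P y) = P x
      rw [hkc ⟨(x, y), hxy⟩ hy, hc y hy, (L.law c).act_unit,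
        hc x (hmem (R.iseqv.symm hxy) hy)]
  · obtain ⟨⟨x, y⟩, hxy⟩ := g
    obtain ⟨⟨y', z⟩, hyz⟩ := g'
    obtain rfl : y = y' := e
    refine Prod.ext rfl ?_
    show k ⟨(x, z), R.iseqv.trans hxy hyz⟩ = L.mul (k ⟨(x, y), hxy⟩) (k ⟨(y, z), hyz⟩) (P z)
    by_cases hz : z ∈ A
    · have hy : y ∈ A := (h.conull.mem_iff hyz).2 hz
      refine (h.choice z hz).eq (hkA ⟨(x, z), R.iseqv.trans hxy hyz⟩ hz) ?_
      refine S.iseqv.trans (h.mul z hz _ _) (S.iseqv.trans ?_ (hkA ⟨(x, y), hxy⟩ hy))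
      exact S.iseqv.symm (h.endo y hy _ _ (S.iseqv.symm (hkA ⟨(y, z), hyz⟩ hz)))
    · have hy : y ∉ A := hmem (R.iseqv.symm hyz) hz
      rw [hkc ⟨(x, z), R.iseqv.trans hxy hyz⟩ hz, hkc ⟨(x, y), hxy⟩ hy, hkc ⟨(y, z), hyz⟩ hz,
        hc z hz, (L.law c).mul_unit]

/-- Arrows ending at `P x` are the inverses of arrows starting there. Passing from `x` to `φ j x`,
which quasi-invariance of `R` permits, exchanges `(P x, j)` with its inverse and so matches the two
null conditions. Invariant sets of units pull back to unions of `R`-classes. -/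
theorem IsQuotientMap.isErgodicMeasured [IsProbabilityMeasure μ]
    (h : IsQuotientMap μ R S φ L A P) (hq : R.toGroupoid.QuasiInvariant μ)
    (he : R.toGroupoid.Ergodic μ) (θ : R.toGroupoid.Hom L.toGroupoid) (hθ : θ.obj = P) :
    L.toGroupoid.IsErgodicMeasured (μ.map P) where
  isProbabilityMeasure := Measure.isProbabilityMeasure_map h.measurable.aemeasurable
  quasiInvariant B hB := by
    have hB : MeasurableSet (B : Set (Y × IndexSet N)) := hB
    have hinv : ∀ y j, L.inv (L.inv j y) (L.act j y) = j := fun y j =>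
      congrArg Prod.snd (DiscreteBorelGroupoid.inv_inv (G := L.toGroupoid) (y, j))
    have hl : L.toGroupoid.leftMass (μ.map P) B = 0 ↔
        ∀ᵐ x ∂μ, ∀ j, (L.act j (P x), L.inv j (P x)) ∉ B := by
      have hm : MeasurableSet {y | ∃ j, (L.act j y, L.inv j y) ∈ B} := by
        have : {y | ∃ j, (L.act j y, L.inv j y) ∈ B} =
            ⋃ j, (fun y => (L.act j y, L.inv j y)) ⁻¹' B := by
          ext y; simp
        rw [this]
        exact .iUnion fun j => ((L.measurable_act j).prodMk (L.measurable_inv j)) hB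
      refine (lintegral_encard_eq_zero_iff hm fun y => ?_).trans ?_
      · constructor
        · rintro ⟨⟨z, i⟩, hg, rfl⟩
          refine ⟨L.inv i z, ?_⟩
          show (L.act (L.inv i z) (L.act i z), L.inv (L.inv i z) (L.act i z)) ∈ B
          rw [(L.law z).act_inv, hinv]
          exact hg
        · rintro ⟨j, hj⟩
          exact ⟨_, hj, (L.law y).act_inv j⟩
      · rw [ae_map_iff h.measurable.aemeasurable hm.compl]
        simp
    have hr : L.toGroupoid.rightMass (μ.map P) B = 0 ↔ ∀ᵐ x ∂μ, ∀ j, (P x, j) ∉ B := by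
      have hm : MeasurableSet {y | ∃ j, (y, j) ∈ B} := by
        have : {y | ∃ j, (y, j) ∈ B} = ⋃ j, (fun y => (y, j)) ⁻¹' B := by
          ext y; simp
        rw [this]
        exact .iUnion fun j => measurable_prodMk_right hB
      refine (lintegral_encard_eq_zero_iff hm fun y => ?_).trans ?_
      · constructor
        · rintro ⟨⟨z, i⟩, hg, rfl⟩
          exact ⟨i, hg⟩
        · rintro ⟨j, hj⟩
          exact ⟨_, hj, rfl⟩
      · rw [ae_map_iff h.measurable.aemeasurable hm.compl]
        simp
    rw [hl, hr]
    constructor <;> intro h0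
    · filter_upwards [ae_forall_rel hq h0, h.conull.ae_mem] with x hx hxA j hj
      refine hx _ ((h.choice x hxA).1 j) (L.inv j (P x)) ?_
      rwa [← h.act x hxA, (L.law _).act_inv, hinv]
    · filter_upwards [ae_forall_rel hq h0, h.conull.ae_mem] with x hx hxA j hj
      rw [h.act x hxA] at hj
      exact hx _ ((h.choice x hxA).1 j) _ hj
  ergodic B hB hinv := by
    have hB : MeasurableSet (B : Set Y) := hB
    rw [Measure.map_apply h.measurable hB]
    refine he _ (h.measurable hB) fun g => ?_
    have := hinv (θ.arr g)
    rw [θ.src_arr, θ.rng_arr, hθ] at this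
    exact this

theorem IsQuotientMap.kerEq [IsFiniteMeasure μ] (h : IsQuotientMap μ R S φ L A P)
    (hSR : ∀ x y, S.r x y → R.r x y) (θ : R.toGroupoid.Hom L.toGroupoid) (hθ : θ.obj = P)
    (hθS : ∀ x y (hxy : R.r x y), y ∈ A → S.r (φ (θ.arr ⟨(x, y), hxy⟩).2 y) x) :
    KerEq μ θ S := by
  filter_upwards [h.conull.ae_mem] with x hx y
  have h1 : ∀ hxy : R.r x y, (θ.arr ⟨(x, y), hxy⟩).1 = P y := fun hxy => by
    rw [← hθ]
    exact θ.src_arr ⟨(x, y), hxy⟩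
  constructor
  · rintro ⟨hxy, z, hz⟩
    have hy := (h.conull.mem_iff hxy).1 hx
    have h2 := hθS x y hxy hy
    have h3 := h1 hxy
    rw [← hz] at h2 h3
    rw [show z = P y from h3] at h2
    exact S.iseqv.trans (S.iseqv.symm h2) (h.unit y hy)
  · intro hxy
    have hxyR := hSR x y hxy
    have hy := (h.conull.mem_iff hxyR).1 hx
    refine ⟨hxyR, P y, Prod.ext (h1 hxyR).symm ?_⟩
    exact (h.choice y hy).eq (S.iseqv.trans (h.unit y hy) (S.iseqv.symm hxy)) (hθS x y hxyR hy)

theorem IsQuotientMap.classSurjective (h : IsQuotientMap μ R S φ L A P)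
    (θ : R.toGroupoid.Hom L.toGroupoid)
    (hθS : ∀ x y (hxy : R.r x y), y ∈ A → S.r (φ (θ.arr ⟨(x, y), hxy⟩).2 y) x) :
    ClassSurjective μ θ := by
  filter_upwards [h.conull.ae_mem] with x hx g hg
  have hR : R.r (φ g.2 x) x := R.iseqv.symm ((h.choice x hx).1 g.2)
  refine ⟨φ g.2 x, hR, Prod.ext ?_ ?_⟩
  · exact (θ.src_arr ⟨(φ g.2 x, x), hR⟩).trans hg.symm
  · exact (h.choice x hx).eq (hθS _ x hR hx) (S.iseqv.refl _)

end QuotientHom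

/-! ### Factorization through the quotient. -/

section Universality

variable {X : Type u} [MeasurableSpace X] [StandardBorelSpace X] {R S : DiscreteBorelEquivRel X}
  {N : ℕ∞} {φ : IndexSet N → X → X} {μ : Measure X} {Y : Type u} [MeasurableSpace Y]
  {L : ArrowLaw Y (IndexSet N)} {A : Set X} {P : X → Y}

/-- The conditions at a unit `y` under which `(ko, ka)` respects the groupoid structure. -/
def IsFunctorialAt (L : ArrowLaw Y (IndexSet N)) (H : DiscreteBorelGroupoid.{u}) (ko : Y → H.Obj)
    (ka : IndexSet N → Y → H.Arr) (M : H.Arr × H.Arr → H.Arr) (y : Y) : Prop :=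
  (∀ j, H.src (ka j y) = ko y) ∧ (∀ j, H.rng (ka j y) = ko (L.act j y)) ∧
    ∀ i j, ka (L.mul i j y) y = M (ka i (L.act j y), ka j y)

theorem measurableSet_isFunctorialAt {H : DiscreteBorelGroupoid.{u}} {ko : Y → H.Obj}
    (hko : Measurable ko) {ka : IndexSet N → Y → H.Arr} (hka : ∀ j, Measurable (ka j))
    {M : H.Arr × H.Arr → H.Arr} (hM : Measurable M) :
    MeasurableSet {y | IsFunctorialAt L H ko ka M y} := by
  have : {y | IsFunctorialAt L H ko ka M y} =
      (⋂ j, {y | H.src (ka j y) = ko y}) ∩ ((⋂ j, {y | H.rng (ka j y) = ko (L.act j y)}) ∩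
        ⋂ i, ⋂ j, {y | ka (L.mul i j y) y = M (ka i (L.act j y), ka j y)}) := by
    ext y
    simp only [mem_inter_iff, mem_iInter, mem_ofPred_eq]
    rfl
  rw [this]
  refine (MeasurableSet.iInter fun j => ?_).inter ((MeasurableSet.iInter fun j => ?_).inter
    (.iInter fun i => .iInter fun j => ?_)) <;> refine measurableSet_eq_fun ?_ ?_
  · exact H.measurable_src.comp (hka j)
  · exact hko
  · exact H.measurable_rng.comp (hka j)
  · exact hko.comp (L.measurable_act j)
  · exact .apply_index hka (L.measurable_mul i j) measurable_id
  · exact hM.comp (((hka i).comp (L.measurable_act j)).prodMk (hka j))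

variable [StandardBorelSpace Y]

/-- A groupoid homomorphism from data that are functorial on an invariant Borel set of units,
trivial off this set. -/
theorem exists_hom_of_isFunctorialAt {H : DiscreteBorelGroupoid.{u}} {ko : Y → H.Obj}
    (hko : Measurable ko) {ka : IndexSet N → Y → H.Arr} (hka : ∀ j, Measurable (ka j))
    {M : H.Arr × H.Arr → H.Arr} (hM : ∀ g h (e : H.src g = H.rng h), M (g, h) = H.mul g h e)
    {Z : Set Y} (hZ : MeasurableSet Z) (hZact : ∀ j y, L.act j y ∈ Z ↔ y ∈ Z)
    (hZf : ∀ y ∈ Z, IsFunctorialAt L H ko ka M y) (z₀ : H.Obj) :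
    ∃ κ : L.toGroupoid.Hom H, (∀ y ∈ Z, κ.obj y = ko y) ∧ ∀ g, g.1 ∈ Z → κ.arr g = ka g.2 g.1 := by
  classical
  let o : Y → H.Obj := fun y => if y ∈ Z then ko y else z₀
  let a : Y × IndexSet N → H.Arr := fun g => if g.1 ∈ Z then ka g.2 g.1 else H.one z₀
  have ho : ∀ y ∈ Z, o y = ko y := fun y hy => if_pos hy
  have ho' : ∀ y ∉ Z, o y = z₀ := fun y hy => if_neg hy
  have ha : ∀ g : Y × IndexSet N, g.1 ∈ Z → a g = ka g.2 g.1 := fun g hg => if_pos hg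
  have ha' : ∀ g : Y × IndexSet N, g.1 ∉ Z → a g = H.one z₀ := fun g hg => if_neg hg
  have hZa : ∀ g : Y × IndexSet N, L.act g.2 g.1 ∈ Z ↔ g.1 ∈ Z := fun g => hZact _ _
  refine ⟨⟨o, a, Measurable.ite hZ hko measurable_const, Measurable.ite (measurable_fst hZ) ?_
    measurable_const, fun g => ?_, fun g => ?_, fun g h e => ?_⟩, ho, ha⟩
  · exact measurable_from_prod_countable_left (f := fun g : Y × IndexSet N => ka g.2 g.1) hka
  · show H.src (a g) = o g.1
    by_cases hg : g.1 ∈ Z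
    · rw [ha g hg, ho _ hg]
      exact (hZf _ hg).1 _
    · rw [ha' g hg, ho' _ hg, H.src_one]
  · show H.rng (a g) = o (L.act g.2 g.1)
    by_cases hg : g.1 ∈ Z
    · rw [ha g hg, ho _ ((hZa g).2 hg)]
      exact (hZf _ hg).2.1 _
    · rw [ha' g hg, ho' _ (fun hh => hg ((hZa g).1 hh)), H.rng_one]
  · have he : g.1 = L.act h.2 h.1 := e
    by_cases hh : h.1 ∈ Z
    · have hg : g.1 ∈ Z := he ▸ (hZa h).2 hh
      rw [← hM]
      show a (h.1, L.mul g.2 h.2 h.1) = M (a g, a h)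
      rw [ha g hg, ha h hh, he]
      exact (ha (h.1, L.mul g.2 h.2 h.1) hh).trans ((hZf _ hh).2.2 _ _)
    · have hg : g.1 ∉ Z := fun hg => hh ((hZa h).1 (he ▸ hg))
      rw [one_mul_of_eq ⟨z₀, (ha' g hg).symm⟩, ha' h hh]
      exact ha' _ hh

/-- By `arr_eq_of_mem_relKer`, the units `θ' x` and the arrows `θ' (φ j x, x)` depend, on a conull
invariant set, only on the `S`-class of `x`, so they descend along `P`; the relations between them
descend too and make the descended maps functorial almost everywhere. -/
theorem IsQuotientMap.isUniversalFor [IsProbabilityMeasure μ]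
    (h : IsQuotientMap μ R S φ L A P) (hq : R.toGroupoid.QuasiInvariant μ)
    (hSR : ∀ x y, S.r x y → R.r x y) (θ : R.toGroupoid.Hom L.toGroupoid) (hθ : θ.obj = P)
    (hθS : ∀ x y (hxy : R.r x y), y ∈ A → S.r (φ (θ.arr ⟨(x, y), hxy⟩).2 y) x) :
    IsUniversalFor μ S θ (μ.map P) := by
  classical
  intro H ν θ' hH hns hker
  obtain ⟨M, hMm, hM⟩ := H.exists_measurable_mul
  have := hH.isProbabilityMeasure
  obtain ⟨z₀⟩ : Nonempty H.Obj := nonempty_of_isProbabilityMeasure ν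
  have : Nonempty H.Obj := ⟨z₀⟩
  have : Nonempty H.Arr := ⟨H.one z₀⟩
  obtain ⟨B, hB, hB'⟩ := exists_isConullInvariant hq (h.conull.ae_mem.and hker)
  have hSB : ∀ x y, S.r x y → (x ∈ B ↔ y ∈ B) := fun x y hxy => hB.mem_iff (hSR x y hxy)
  have hBA : ∀ x ∈ B, x ∈ A := fun x hx => (hB' x hx).1
  have hBk : ∀ x ∈ B, ∀ y, S.r x y → (x, y) ∈ relKer θ' := fun x hx => (hB' x hx).2
  have hφB : ∀ x ∈ B, ∀ j, φ j x ∈ B := fun x hx j =>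
    (hB.mem_iff ((h.choice x (hBA x hx)).1 j)).1 hx
  -- the maps `x ↦ θ' x` and `x ↦ θ' (φ j x, x)` descend along `P`
  obtain ⟨ko, hko, hkoP⟩ := h.generates.exists_factor (f := fun x => if x ∈ B then θ'.obj x else z₀)
    (measurable_invariants (Measurable.ite hB.measurableSet θ'.measurable_obj measurable_const)
      fun x y hxy => by
        by_cases hx : x ∈ B
        · rw [if_pos hx, if_pos ((hSB x y hxy).1 hx)]
          exact obj_eq_of_mem_relKer θ' (hBk x hx y hxy)
        · rw [if_neg hx, if_neg fun hy => hx ((hSB x y hxy).2 hy)])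
  let f : IndexSet N → X → X := fun j x => if x ∈ B then φ j x else x
  have hfm : ∀ j, Measurable (f j) := fun j =>
    Measurable.ite hB.measurableSet (h.measurable_choice j) measurable_id
  have hfφ : ∀ x ∈ B, ∀ j, f j x = φ j x := fun x hx j => if_pos hx
  have hfR : ∀ j x, R.r (f j x) x := fun j x => by
    by_cases hx : x ∈ B
    · rw [hfφ x hx]
      exact R.iseqv.symm ((h.choice x (hBA x hx)).1 j)
    · simp only [f, if_neg hx]
      exact R.iseqv.refl x
  have hka : ∀ j, ∃ k : Y → H.Arr, Measurable k ∧
      ∀ᵐ x ∂μ, x ∈ B → θ'.arr ⟨(f j x, x), hfR j x⟩ = k (P x) := by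
    intro j
    obtain ⟨k, hk, hkP⟩ := h.generates.exists_factor
      (f := fun x => if x ∈ B then θ'.arr ⟨(f j x, x), hfR j x⟩ else H.one z₀)
      (measurable_invariants (Measurable.ite hB.measurableSet
        (θ'.measurable_arr.comp ((hfm j).prodMk measurable_id).subtype_mk) measurable_const)
        fun x y hxy => by
          by_cases hx : x ∈ B
          · have hy := (hSB x y hxy).1 hx
            rw [if_pos hx, if_pos hy]
            refine arr_eq_of_mem_relKer θ' ?_ (hBk y hy x (S.iseqv.symm hxy)) _ _
            rw [hfφ x hx, hfφ y hy]
            exact hBk _ (hφB x hx j) _ (h.endo x (hBA x hx) j y hxy)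
          · rw [if_neg hx, if_neg fun hy => hx ((hSB x y hxy).2 hy)])
    exact ⟨k, hk, hkP.mono fun x hx hxB => by rw [← hx, if_pos hxB]⟩
  choose ka hkam hkaP using hka
  obtain ⟨C, hC, hC'⟩ := exists_isConullInvariant hq
    (hB.ae_mem.and (hkoP.and (ae_all_iff.2 hkaP)))
  have hCB : ∀ x ∈ C, x ∈ B := fun x hx => (hC' x hx).1
  have hCo : ∀ x ∈ C, ko (P x) = θ'.obj x := fun x hx => by
    rw [← (hC' x hx).2.1, if_pos (hCB x hx)]
  have hCa : ∀ x ∈ C, ∀ j, ka j (P x) = θ'.arr ⟨(f j x, x), hfR j x⟩ := fun x hx j =>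
    ((hC' x hx).2.2 j (hCB x hx)).symm
  have hact : ∀ x ∈ C, ∀ j, L.act j (P x) = P (f j x) := fun x hx j => by
    rw [h.act x (hBA x (hCB x hx)), hfφ x (hCB x hx)]
  have hfC : ∀ x ∈ C, ∀ j, f j x ∈ C := fun x hx j => (hC.mem_iff (hfR j x)).2 hx
  have hfun : ∀ x ∈ C, IsFunctorialAt L H ko ka M (P x) := by
    intro x hx
    refine ⟨fun j => ?_, fun j => ?_, fun i j => ?_⟩
    · rw [hCa x hx, hCo x hx]
      exact θ'.src_arr _
    · rw [hCa x hx, hact x hx, hCo _ (hfC x hx j)]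
      exact θ'.rng_arr _
    · rw [hact x hx, hCa _ (hfC x hx j), hCa x hx, hCa x hx]
      obtain ⟨e, h1⟩ := arr_mul_rel θ' (hfR i (f j x)) (hfR j x)
      rw [hM _ _ e, ← h1]
      refine arr_eq_of_mem_relKer θ' ?_ (hBk x (hCB x hx) x (S.iseqv.refl x)) _ _
      rw [hfφ _ (hCB _ (hfC x hx j)), hfφ x (hCB x hx), hfφ x (hCB x hx)]
      exact hBk _ (hφB x (hCB x hx) _) _ (h.mul x (hBA x (hCB x hx)) i j)
  -- Quantifying over the orbit makes `Z` invariant, so `κ` can be made trivial off `Z` without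
  -- breaking functoriality.
  let Z : Set Y := {y | ∀ j, IsFunctorialAt L H ko ka M (L.act j y)}
  have hZ : MeasurableSet Z := by
    have : Z = ⋂ j, L.act j ⁻¹' {y | IsFunctorialAt L H ko ka M y} := by
      ext y; simp [Z]
    rw [this]
    exact .iInter fun j => L.measurable_act j (measurableSet_isFunctorialAt hko hkam hMm)
  have hZ1 : ∀ j y, y ∈ Z → L.act j y ∈ Z := fun j y hy i => by
    rw [← (L.law y).act_mul]
    exact hy _
  have hZact : ∀ j y, L.act j y ∈ Z ↔ y ∈ Z := fun j y =>
    ⟨fun hy => (L.law y).act_inv j ▸ hZ1 (L.inv j y) _ hy, hZ1 j y⟩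
  have hPZ : ∀ x ∈ C, P x ∈ Z := fun x hx j => by
    rw [hact x hx]
    exact hfun _ (hfC x hx j)
  obtain ⟨κ, hκo, hκa⟩ := exists_hom_of_isFunctorialAt hko hkam hM hZ hZact
    (fun y hy => (L.law y).act_unit ▸ hy (L.unit y)) z₀
  refine ⟨κ, ?_, ?_⟩
  -- `κ.obj ∘ P` and `θ'.obj` agree almost everywhere, so nonsingularity passes from `θ'` to `κ`.
  · have : (μ.map P).map κ.obj = μ.map θ'.obj := by
      rw [Measure.map_map κ.measurable_obj h.measurable]
      refine Measure.map_congr ?_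
      filter_upwards [hC.ae_mem] with x hx
      rw [Function.comp_apply, hκo _ (hPZ x hx), hCo x hx]
    show ((μ.map P).map κ.obj).AbsolutelyContinuous ν
    rw [this]
    exact hns
  · filter_upwards [hC.ae_mem] with x hx y hxy
    have hy : y ∈ C := (hC.mem_iff hxy).1 hx
    have h1 : (θ.arr ⟨(x, y), hxy⟩).1 = P y := by
      rw [← hθ]
      exact θ.src_arr ⟨(x, y), hxy⟩
    rw [hκa _ (h1 ▸ hPZ y hy), h1, hCa y hy]
    refine arr_eq_of_mem_relKer θ' ?_ (hBk y (hCB y hy) y (S.iseqv.refl y)) _ _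
    rw [hfφ y (hCB y hy)]
    exact hBk _ (hφB y (hCB y hy) _) _ (hθS x y hxy (hBA y (hCB y hy)))

end Universality

end

/-! ### The equivalence of the normality conditions. -/

theorem mainTheorem3 {X : Type u} [MeasurableSpace X] [StandardBorelSpace X]
    (μ : Measure X) [IsProbabilityMeasure μ] (R S : DiscreteBorelEquivRel X)
    (hquasi : R.toGroupoid.QuasiInvariant μ) (herg : R.toGroupoid.Ergodic μ)
    (hSR : ∀ x y, S.r x y → R.r x y) :
    (∃ (N : ℕ∞) (φ : IndexSet N → X → X), IsChoiceFamily μ R S φ) ∧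
    ∀ (N : ℕ∞) (φ : IndexSet N → X → X), IsChoiceFamily μ R S φ →
      List.TFAE [
        IsCoboundaryOn μ S (indexCocycle S φ),
        ∃ φ' : IndexSet N → X → X, IsChoiceFamily μ R S φ' ∧ ∀ j, IsEndomorphism μ S (φ' j),
        IsZimmerNormal μ S (indexCocycle S φ),
        ∃ (H : DiscreteBorelGroupoid.{u}) (ν : Measure H.Obj) (θ : R.toGroupoid.Hom H),
          H.IsErgodicMeasured ν ∧ θ.Nonsingular μ ν ∧ KerEq μ θ S ∧ ClassSurjective μ θ ∧
            IsUniversalFor μ S θ ν,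
        ∃ (G : DiscreteBorelGroupoid.{u}) (c : R.toGroupoid.Hom G), KerEq μ c S] := by
  refine ⟨exists_isChoiceFamily hquasi herg S, fun N φ hφ => ?_⟩
  tfae_have 1 → 2 := exists_endomorphisms_of_isCoboundaryOn hquasi hSR hφ
  tfae_have 1 → 3 := isZimmerNormal_of_isCoboundaryOn
  tfae_have 3 → 1 := isCoboundaryOn_of_isZimmerNormal hquasi hSR hφ
  tfae_have 2 → 4 := by
    rintro ⟨φ', hφ', he⟩
    have : Nonempty X := nonempty_of_isProbabilityMeasure μ
    obtain ⟨Y, _, _, L, A, P, h⟩ := exists_isQuotientMap hquasi hSR hφ' he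
    obtain ⟨θ, hθ, hθS⟩ := h.exists_hom
    refine ⟨L.toGroupoid, μ.map P, θ, h.isErgodicMeasured hquasi herg θ hθ, ?_,
      h.kerEq hSR θ hθ hθS, h.classSurjective θ hθS, h.isUniversalFor hquasi hSR θ hθ hθS⟩
    -- The measure on units is the image of `μ` under `P`, so nonsingularity is reflexivity of
    -- absolute continuity.
    rw [DiscreteBorelGroupoid.Hom.Nonsingular, hθ]
  tfae_have 4 → 5 := fun ⟨H, _, θ, _, _, hk, _⟩ => ⟨H, θ, hk⟩
  tfae_have 5 → 1 := fun ⟨_, c, hc⟩ => isCoboundaryOn_of_kerEq hquasi hSR hφ c hc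
  tfae_finish
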